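/- Theorem. A relational event graph $G$ consists of a vertex set $V=\{0,\dots,n-1\}$ and a sequence of edges $e_0,\dots,e_{m-1}$, each a pair of vertices (repetitions and self-loops are allowed, and the order inside a pair is ignored). For $0\le i\le j<m$ the slice $G_{i,j}$ is the multigraph with vertex set $V$ and edges $e_k$, $i\le k\le j$. A component is nontrivial if it has more than one vertex, and an edge $e_k$ of $G_{i,j}$ is loopy if it closes a cycle, i.e. if its endpoints are already connected by the edges $e_l$, $i\le l<k$. A dominance counting data set is a set of $N$ points $(x,y)$ with integer coordinates $1\le y\le x\le N$; a dominance counting query asks for the number of its points in one of the four closed quadrants at an integer query point. The problems of determining, for a query pair $i\le j$, (a) the number of connected components of $G_{i,j}$, (b) its number of nontrivial components, (c) the average number of vertices of its components, (d) the average number of vertices of its nontrivial components (if there are any), and (e) its number of loopy edges can be reduced to dominance counting in $O(m\log n)$ time and linear space. That is, there are a constant $K$ and a word RAM program (unit-cost arithmetic and comparisons on words of $O(\log(n+m))$ bits, memory initially zero) which, on input $G$, uses $O(m\log n)$ time (more precisely $O(1+m(1+\log n))$, which also covers $m=0$ and $n=1$) and $O(n+m+1)$ memory cells and outputs $K$ dominance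 counting data sets, each with $O(m)$ points; and there are fixed expressions in $n$, $m$, $i$, $j$ and integer constants, formed by additions, subtractions and dominance counting queries in these $K$ data sets, not depending on $G,i,j$, whose values are the answers to (a), (b) and (e) for every slice, while (c) and (d) are quotients of two such values, with nonzero denominator. In particular every slice query takes $O(1)$ dominance counting queries and $O(1)$ further operations. -/

import Mathlib

/-! ## Relational event graphs and their slices -/

/-- A relational event graph on the vertex set `{0, …, n - 1}`: a sequence of `m` edges, each a pair
of vertices. Repeated edges and self-loops are allowed; all notions below ignore the order inside a
pair, so both directed and undirected edge sequences are covered. -/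
structure RelationalEventGraph (n m : ℕ) where
  edge : Fin m → Fin n × Fin n

namespace RelationalEventGraph

variable {n m : ℕ} (G : RelationalEventGraph n m)

/-- The adjacency structure (which determines the connectivity) of the multigraph with all the
vertices and with the edges `e_k`, `a ≤ k < b`. -/
def window (a b : ℕ) : SimpleGraph (Fin n) :=
  SimpleGraph.fromRel fun u v => ∃ k : Fin m, a ≤ (k : ℕ) ∧ (k : ℕ) < b ∧ G.edge k = (u, v)

/-- The slice `G_{i,j}`, with the edges `e_k`, `i ≤ k ≤ j`. -/
def slice (i j : ℕ) : SimpleGraph (Fin n) := G.window i (j + 1)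

/-- The number of connected components of `G_{i,j}`. -/
noncomputable def numComponents (i j : ℕ) : ℕ :=
  Nat.card (G.slice i j).ConnectedComponent

/-- The number of components of `G_{i,j}` that have more than one vertex. -/
noncomputable def numNontrivial (i j : ℕ) : ℕ :=
  Nat.card {c : (G.slice i j).ConnectedComponent // 1 < c.supp.ncard}

/-- The average number of vertices of a component of `G_{i,j}`. -/
noncomputable def avgComponentSize (i j : ℕ) : ℚ :=
  (∑ᶠ c : (G.slice i j).ConnectedComponent, (c.supp.ncard : ℚ)) / G.numComponents i j

/-- The average number of vertices of a nontrivial component of `G_{i,j}` (meaningful when there is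
such a component). -/
noncomputable def avgNontrivialSize (i j : ℕ) : ℚ :=
  (∑ᶠ c : {c : (G.slice i j).ConnectedComponent // 1 < c.supp.ncard}, (c.1.supp.ncard : ℚ)) /
    G.numNontrivial i j

/-- The number of loopy edges of `G_{i,j}`: the edges `e_k`, `i ≤ k ≤ j`, that close a cycle, that
is, whose endpoints are already connected by the edges of the slice that precede `e_k`. -/
noncomputable def numLoopyEdges (i j : ℕ) : ℕ :=
  Nat.card {k : Fin m // i ≤ (k : ℕ) ∧ (k : ℕ) ≤ j ∧
    (G.window i k).Reachable (G.edge k).1 (G.edge k).2}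

end RelationalEventGraph

/-! ## The word RAM

Programs are structured (`while`) programs over finitely many registers and a random access memory.
All operations have unit cost. A run is relative to a number `S` of available memory cells and a
bound `W` on the contents of a word; it is stuck as soon as it leaves these limits. -/

namespace RAM

/-- The arithmetic and comparison instructions. -/
inductive Op where
  | add | sub | mul | div | mod | lt | eq

/-- The effect of an instruction on natural numbers; subtraction is truncated, division by zero is
not defined, comparisons return `1` or `0`. -/
def Op.apply : Op → ℕ → ℕ → Option ℕ
  | .add, a, b => some (a + b)
  | .sub, a, b => some (a - b)
  | .mul, a, b => some (a * b)
  | .div, a, b => if b = 0 then none else some (a / b)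
  | .mod, a, b => if b = 0 then none else some (a % b)
  | .lt, a, b => some (if a < b then 1 else 0)
  | .eq, a, b => some (if a = b then 1 else 0)

/-- Expressions: constants, registers, memory reads, operations. -/
inductive Expr where
  | lit (c : ℕ)
  | reg (x : ℕ)
  | load (addr : Expr)
  | bin (op : Op) (a b : Expr)

/-- The contents of the registers and of the memory. -/
structure State where
  reg : ℕ → ℕ
  mem : ℕ → ℕ

/-- A computed value has to fit into a word. -/
def word (W v : ℕ) : Option ℕ := if v < W then some v else none

/-- The value of an expression with `S` memory cells of words less than `W`; `none` if stuck. -/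
def Expr.eval (S W : ℕ) (σ : State) : Expr → Option ℕ
  | .lit c => word W c
  | .reg x => word W (σ.reg x)
  | .load e => (e.eval S W σ).bind fun a => if a < S then word W (σ.mem a) else none
  | .bin op e f => (e.eval S W σ).bind fun a => (f.eval S W σ).bind fun b =>
      (op.apply a b).bind (word W)

/-- The time needed to evaluate an expression: one step per node. -/
def Expr.cost : Expr → ℕ
  | .lit _ => 1
  | .reg _ => 1
  | .load e => e.cost + 1
  | .bin _ e f => e.cost + f.cost + 1

/-- Programs. -/
inductive Prog where
  | skip
  | set (x : ℕ) (e : Expr)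
  | store (addr e : Expr)
  | seq (p q : Prog)
  | ite (e : Expr) (p q : Prog)
  | loop (e : Expr) (p : Prog)

/-- `Exec S W p σ t σ'`: started in `σ`, the program `p` halts in `σ'` after `t` steps, never using
a memory cell outside `{0, …, S - 1}` nor a word that is not less than `W`. The statement
`loop e p` repeats `p` as long as `e` is nonzero. -/
inductive Exec (S W : ℕ) : Prog → State → ℕ → State → Prop where
  | skip (σ : State) : Exec S W .skip σ 1 σ
  | set (σ : State) (x : ℕ) (e : Expr) (v : ℕ) (he : e.eval S W σ = some v) :
      Exec S W (.set x e) σ (e.cost + 1) ⟨Function.update σ.reg x v, σ.mem⟩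
  | store (σ : State) (d e : Expr) (a v : ℕ) (hd : d.eval S W σ = some a) (ha : a < S)
      (he : e.eval S W σ = some v) :
      Exec S W (.store d e) σ (d.cost + e.cost + 1) ⟨σ.reg, Function.update σ.mem a v⟩
  | seq (σ₁ σ₂ σ₃ : State) (p q : Prog) (s t : ℕ) (hp : Exec S W p σ₁ s σ₂)
      (hq : Exec S W q σ₂ t σ₃) : Exec S W (.seq p q) σ₁ (s + t) σ₃
  | ite_true (σ σ' : State) (e : Expr) (p q : Prog) (v t : ℕ) (he : e.eval S W σ = some v)
      (hv : v ≠ 0) (hp : Exec S W p σ t σ') : Exec S W (.ite e p q) σ (e.cost + t + 1) σ'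
  | ite_false (σ σ' : State) (e : Expr) (p q : Prog) (t : ℕ) (he : e.eval S W σ = some 0)
      (hq : Exec S W q σ t σ') : Exec S W (.ite e p q) σ (e.cost + t + 1) σ'
  | loop_true (σ₁ σ₂ σ₃ : State) (e : Expr) (p : Prog) (v s t : ℕ) (he : e.eval S W σ₁ = some v)
      (hv : v ≠ 0) (hp : Exec S W p σ₁ s σ₂) (hl : Exec S W (.loop e p) σ₂ t σ₃) :
      Exec S W (.loop e p) σ₁ (e.cost + s + t + 1) σ₃
  | loop_false (σ : State) (e : Expr) (p : Prog) (he : e.eval S W σ = some 0) :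
      Exec S W (.loop e p) σ (e.cost + 1) σ

/-- The initial state on input `G`: registers `0` and `1` hold `n` and `m`, the endpoints of `e_k`
are in the cells `2 k` and `2 k + 1`, all the rest is zero. -/
def input {n m : ℕ} (G : RelationalEventGraph n m) : State where
  reg x := if x = 0 then n else if x = 1 then m else 0
  mem a := if h : a / 2 < m then
      (if a % 2 = 0 then ((G.edge ⟨a / 2, h⟩).1 : ℕ) else ((G.edge ⟨a / 2, h⟩).2 : ℕ))
    else 0

/-- The `s`-th point set in the output: register `2 s` holds the address where it begins, register
`2 s + 1` the number of points, and each point takes up two consecutive cells. -/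
def output (σ : State) (s : ℕ) : List (ℕ × ℕ) :=
  (List.range (σ.reg (2 * s + 1))).map fun t =>
    (σ.mem (σ.reg (2 * s) + 2 * t), σ.mem (σ.reg (2 * s) + 2 * t + 1))

/-- The first `K` point sets in the output. -/
def outputs (K : ℕ) (σ : State) : Fin K → List (ℕ × ℕ) := fun s => output σ s

/-- The `s`-th point set in the output lies inside the `S` memory cells. -/
def OutputFits (S : ℕ) (σ : State) (s : ℕ) : Prop :=
  σ.reg (2 * s) + 2 * σ.reg (2 * s + 1) ≤ S

end RAM

/-! ## Dominance counting -/

namespace Dominance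

/-- A data set for dominance counting: `N` distinct points `(x, y)` with integer coordinates
satisfying `1 ≤ y ≤ x ≤ N`. -/
def IsInstance (P : List (ℕ × ℕ)) : Prop :=
  P.Nodup ∧ ∀ p ∈ P, 1 ≤ p.2 ∧ p.2 ≤ p.1 ∧ p.1 ≤ P.length

/-- The four (closed) quadrants at a query point: the first component tells whether `x ≤ x₀` or
`x ≥ x₀`, the second whether `y ≤ y₀` or `y ≥ y₀`. -/
inductive Quadrant where
  | lele | lege | gele | gege

/-- Membership of `(x, y)` in a quadrant at `(x₀, y₀)`. -/
def Quadrant.Contains : Quadrant → ℤ × ℤ → ℤ × ℤ → Prop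
  | .lele, q, p => p.1 ≤ q.1 ∧ p.2 ≤ q.2
  | .lege, q, p => p.1 ≤ q.1 ∧ q.2 ≤ p.2
  | .gele, q, p => q.1 ≤ p.1 ∧ p.2 ≤ q.2
  | .gege, q, p => q.1 ≤ p.1 ∧ q.2 ≤ p.2

open Classical in
/-- The answer to a dominance counting query. -/
noncomputable def count (P : List (ℕ × ℕ)) (Q : Quadrant) (q : ℤ × ℤ) : ℕ :=
  P.countP fun p => decide (Q.Contains q ((p.1 : ℤ), (p.2 : ℤ)))

/-- A query procedure that has access to dominance counting in `K` point sets: a fixed expression in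
`n`, `m`, the bounds `i`, `j` of the slice and integer constants, formed by additions, subtractions
and dominance counting queries. Being a fixed expression, it takes constant time apart from a
constant number of dominance counting queries. -/
inductive Query (K : ℕ) where
  | const (c : ℤ)
  | numVertices
  | numEdges
  | first
  | last
  | add (a b : Query K)
  | sub (a b : Query K)
  | dominance (s : Fin K) (Q : Quadrant) (x y : Query K)

/-- The result of a query procedure for the slice `i, j`, when the point sets are `P`. -/
noncomputable def Query.eval {K : ℕ} (P : Fin K → List (ℕ × ℕ)) (n m i j : ℕ) : Query K → ℤ
  | .const c => c
  | .numVertices => n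
  | .numEdges => m
  | .first => i
  | .last => j
  | .add a b => a.eval P n m i j + b.eval P n m i j
  | .sub a b => a.eval P n m i j - b.eval P n m i j
  | .dominance s Q x y => count (P s) Q (x.eval P n m i j, y.eval P n m i j)

end Dominance

/-! Counting. When the edges of a slice are added one by one, each edge either merges two components
or is loopy, so the number of components is `n` minus the number of edges plus the number of loopy
edges (`card_components`). Trivial components are the vertices that meet no edge other than
self-loops, so the other quantities need only the number of touched vertices. Each touched vertex is
charged to the edge of the slice that touches it first, separately for first and second endpoints
(`card_touchedSet`).

Points. For a fixed edge `l`, being loopy in a slice that starts at `i ≤ l` depends only on the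
edges before `l`, and holds exactly for `i` below some bound; being the first to touch an endpoint
holds exactly for `i` above some bound, or never for a self-loop. Each edge therefore gives one
point in each of three sets, with abscissa `l + 2` and the bound as ordinate. One extra point `(1,
1)` makes room for abscissas up to `m + 1`. The counts over a slice become dominance counts
(`count_lege`, `count_gele`).

Bounds. For touching, the last non-loop edge at each vertex is remembered. For loops the bound is a
bottleneck: the largest `w` such that the endpoints are connected by earlier edges of index at least
`w - 1`. A rooted forest is maintained whose edges of weight more than `i` connect the same vertices
as the edges since `i`, for all `i` at once. The local move `promote` preserves this
(`promote_conn`). To insert an edge `uv`, first `u` and then `v` is promoted to a root; now `u` is a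
root or a child of `v`, and the weight above `u` is the bottleneck (`Inv.conn_iff`). Then `u` is
hung below `v` with the largest weight so far, which makes a previous edge between them redundant
(`link_conn`).

Time. The potential is the sum of the binary logarithms of the subtree sizes. While `u` is moved up,
if its parent has more than two thirds of the subtree of its grandparent, the parent is promoted and
the potential drops by at least one (`pot_promote_heavy`). Otherwise `u` is promoted and the
logarithmic size of its parent grows by at least one half (`lsize_add_half_le`), which this size can
afford only `O(log n)` times. So an insertion takes amortized time `O(log n)` (`exec_perchLoop`,
`exec_insert`). -/

/-! ## Rooted forests with bottleneck weights -/

/-- A rooted forest on the vertices `1, …, n`: `par v` is the parent of `v` (`0` for a root), `wt v`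
is the weight of the edge to the parent, `ex v` is the number of proper descendants of `v`. -/
@[ext]
structure Forest where
  par : ℕ → ℕ
  wt : ℕ → ℕ
  ex : ℕ → ℕ

namespace Forest

/-- Move `x` one level up, either next to its parent or above it, so that for every threshold the
edges above it connect the same pairs of vertices. -/
def promote (F : Forest) (x : ℕ) : Forest :=
  if F.wt (F.par x) < F.wt x then
    ⟨Function.update (Function.update F.par (F.par x) x) x (F.par (F.par x)),
      Function.update (Function.update F.wt x (F.wt (F.par x))) (F.par x) (F.wt x),
      Function.update (Function.update F.ex (F.par x) (F.ex (F.par x) - F.ex x - 1)) x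
        (F.ex (F.par x))⟩
  else
    ⟨Function.update F.par x (F.par (F.par x)), F.wt,
      Function.update F.ex (F.par x) (F.ex (F.par x) - F.ex x - 1)⟩

/-- Well-formed forests on `1, …, n` with weights at most `k`. -/
structure Inv (n k : ℕ) (F : Forest) : Prop where
  par_le : ∀ v, F.par v ≤ n
  par_out : ∀ v, v = 0 ∨ n < v → F.par v = 0
  wt_iff : ∀ v, F.wt v = 0 ↔ F.par v = 0
  wt_le : ∀ v, F.wt v ≤ k
  ex_eq : ∀ y ∈ Finset.Icc 1 n,
    F.ex y = ∑ x ∈ Finset.Icc 1 n, if F.par x = y then F.ex x + 1 else 0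
  ex_lt : ∀ y ∈ Finset.Icc 1 n, F.ex y < n
  ex_zero : F.ex 0 = 0

/-- Connectivity by the edges of weight more than `i`. -/
def Conn (F : Forest) (i : ℕ) : ℕ → ℕ → Prop :=
  Relation.EqvGen fun a b => F.par a = b ∧ i < F.wt a

theorem eqvGen_le {α : Type*} {r s : α → α → Prop} (h : ∀ a b, r a b → Relation.EqvGen s a b)
    {a b : α} (hab : Relation.EqvGen r a b) : Relation.EqvGen s a b := by
  induction hab with
  | rel a b h' => exact h _ _ h'
  | refl a => exact .refl a
  | symm a b _ ih => exact .symm _ _ ih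
  | trans a b c _ _ ih₁ ih₂ => exact .trans _ _ _ ih₁ ih₂

/-- A promotion or a link affects the summands of two vertices only. The subtraction-free form
serves both the descendant counts in `ℕ` and the potential in `ℝ`. -/
theorem sum_change_two {M : Type*} [AddCommMonoid M] {n x y : ℕ} (hx : x ∈ Finset.Icc 1 n)
    (hy : y ∈ Finset.Icc 1 n) (hxy : x ≠ y) {f g : ℕ → M}
    (h : ∀ a, a ≠ x → a ≠ y → f a = g a) :
    (∑ a ∈ Finset.Icc 1 n, f a) + (g x + g y) = (∑ a ∈ Finset.Icc 1 n, g a) + (f x + f y) := by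
  have hy' : y ∈ (Finset.Icc 1 n).erase x := Finset.mem_erase.2 ⟨hxy.symm, hy⟩
  rw [← Finset.add_sum_erase _ f hx, ← Finset.add_sum_erase _ g hx,
    ← Finset.add_sum_erase _ f hy', ← Finset.add_sum_erase _ g hy']
  have : ∑ a ∈ ((Finset.Icc 1 n).erase x).erase y, f a =
      ∑ a ∈ ((Finset.Icc 1 n).erase x).erase y, g a := by
    apply Finset.sum_congr rfl
    intro a ha
    simp only [Finset.mem_erase] at ha
    exact h a ha.2.1 ha.1
  rw [this]
  abel

variable {n k : ℕ} {F : Forest}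

theorem Inv.mem (hF : F.Inv n k) {x : ℕ} (hx : F.par x ≠ 0) : x ∈ Finset.Icc 1 n := by
  rw [Finset.mem_Icc]
  by_contra h
  exact hx (hF.par_out x (by omega))

theorem Inv.par_mem (hF : F.Inv n k) {x : ℕ} (hx : F.par x ≠ 0) : F.par x ∈ Finset.Icc 1 n := by
  have := hF.par_le x
  rw [Finset.mem_Icc]
  omega

/-- The parent counts `x` in addition to the descendants of `x`. This strict growth replaces an
acyclicity axiom in `Inv`. -/
theorem Inv.ex_lt_par (hF : F.Inv n k) {x : ℕ} (hx : F.par x ≠ 0) :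
    F.ex x < F.ex (F.par x) := by
  rw [hF.ex_eq _ (hF.par_mem hx)]
  have := Finset.single_le_sum (f := fun a => if F.par a = F.par x then F.ex a + 1 else 0)
    (fun _ _ => Nat.zero_le _) (hF.mem hx)
  simp only [if_true] at this
  omega

theorem Inv.par_ne (hF : F.Inv n k) {x : ℕ} (hx : F.par x ≠ 0) : F.par x ≠ x := by
  intro h
  have := hF.ex_lt_par hx
  rw [h] at this
  omega

theorem Inv.par_zero (hF : F.Inv n k) : F.par 0 = 0 := hF.par_out 0 (.inl rfl)

theorem Inv.par_par_ne (hF : F.Inv n k) {x : ℕ} (hx : F.par x ≠ 0) : F.par (F.par x) ≠ x := by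
  intro h
  have h0 : x ≠ 0 := by
    have := Finset.mem_Icc.1 (hF.mem hx)
    omega
  have h1 := hF.ex_lt_par hx
  have h2 := hF.ex_lt_par (x := F.par x) (by rw [h]; exact h0)
  rw [h] at h2
  omega

/-- Roots have weight `0` and all other vertices positive weight, so promoting a child of a root
always exchanges the two. -/
theorem Inv.wt_par_lt (hF : F.Inv n k) {x : ℕ} (hx : F.par x ≠ 0) (h : F.par (F.par x) = 0) :
    F.wt (F.par x) < F.wt x := by
  rw [(hF.wt_iff _).2 h]
  exact Nat.pos_of_ne_zero fun h => hx ((hF.wt_iff _).1 h)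

theorem Inv.par_par_ne_par (hF : F.Inv n k) {x : ℕ} (hx : F.par x ≠ 0) :
    F.par (F.par x) ≠ F.par x := by
  by_cases h : F.par (F.par x) = 0
  · rw [h]; exact hx.symm
  · exact hF.par_ne h

theorem promote_par_self (F : Forest) (x : ℕ) :
    (F.promote x).par x = F.par (F.par x) := by
  unfold promote
  split_ifs <;> simp

theorem promote_par_of_ne {x a : ℕ} (h₁ : a ≠ x) (h₂ : a ≠ F.par x) :
    (F.promote x).par a = F.par a := by
  unfold promote
  split_ifs <;> simp [h₁, h₂]

theorem promote_ex_of_ne {x a : ℕ} (h₁ : a ≠ x) (h₂ : a ≠ F.par x) :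
    (F.promote x).ex a = F.ex a := by
  unfold promote
  split_ifs <;> simp [h₁, h₂]

theorem promote_ex_par (hF : F.Inv n k) {x : ℕ} (hx : F.par x ≠ 0) :
    (F.promote x).ex (F.par x) = F.ex (F.par x) - F.ex x - 1 := by
  have := hF.par_ne hx
  unfold promote
  split_ifs <;> simp [this]

theorem promote_ex_self (hF : F.Inv n k) {x : ℕ} (hx : F.par x ≠ 0) :
    (F.promote x).ex x = F.ex x ∨ (F.promote x).ex x = F.ex (F.par x) := by
  have := (hF.par_ne hx).symm
  unfold promote
  split_ifs <;> simp [this]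

theorem promote_par_root (hF : F.Inv n k) {x : ℕ} (hx : F.par x ≠ 0) (h : F.par (F.par x) = 0) :
    (F.promote x).par (F.par x) = x := by
  have := hF.par_ne hx
  unfold promote
  rw [if_pos (hF.wt_par_lt hx h)]
  simp [this]

theorem promote_inv (hF : F.Inv n k) {x : ℕ} (hx : F.par x ≠ 0) : (F.promote x).Inv n k := by
  have hxm := hF.mem hx
  have hym := hF.par_mem hx
  have hxy := hF.par_ne hx
  have hzx := hF.par_par_ne hx
  have hzy := hF.par_par_ne_par hx
  have hlt := hF.ex_lt_par hx
  have hxi := Finset.mem_Icc.1 hxm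
  have hyi := Finset.mem_Icc.1 hym
  have hz : F.wt (F.par x) = 0 ↔ F.par (F.par x) = 0 := hF.wt_iff _
  have hwx : F.wt x ≠ 0 := fun h => hx ((hF.wt_iff _).1 h)
  have hyl := hF.par_le (F.par x)
  have hroot : F.par (F.par x) = 0 → F.wt (F.par x) < F.wt x := hF.wt_par_lt hx
  refine ⟨fun v => ?_, fun v hv => ?_, fun v => ?_, fun v => ?_, fun a ha => ?_, fun a ha => ?_,
    ?_⟩
  · have := hF.par_le v
    unfold promote
    split_ifs <;> simp only [Function.update_apply] <;> split_ifs <;> omega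
  · rw [promote_par_of_ne (by omega) (by omega)]
    exact hF.par_out v hv
  · have := hF.wt_iff v
    unfold promote
    split_ifs with h
    · simp only [Function.update_apply]
      split_ifs with h1 h2 h3
      · exact absurd (h2.symm.trans h1).symm hxy
      · subst h1; simp [hwx]; omega
      · exact hz
      · exact this
    · simp only [Function.update_apply]
      split_ifs with h1
      · subst h1
        constructor
        · intro h; exact absurd h hwx
        · intro h'; exact absurd (hroot h') h
      · exact this
  · have h1 := hF.wt_le v
    have h2 := hF.wt_le x
    have h3 := hF.wt_le (F.par x)
    unfold promote
    split_ifs <;> simp only [Function.update_apply] <;> (try split_ifs) <;> omega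
  -- Only `x` and its old parent contribute differently to the count at `a`; what remains is
  -- arithmetic, according to whether `a` is `x`, that parent, or another vertex.
  · have hch := sum_change_two (f := fun b => if (F.promote x).par b = a then
      (F.promote x).ex b + 1 else 0) (g := fun b => if F.par b = a then F.ex b + 1 else 0)
      hxm hym hxy.symm (fun b h1 h2 => by
        simp only [promote_par_of_ne h1 h2, promote_ex_of_ne h1 h2])
    rw [← hF.ex_eq a ha] at hch
    generalize (∑ b ∈ Finset.Icc 1 n, if (F.promote x).par b = a then
      (F.promote x).ex b + 1 else 0) = T at hch ⊢
    have ha' := Finset.mem_Icc.1 ha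
    by_cases hc : F.wt (F.par x) < F.wt x
    · simp only [promote, hc, Function.update_apply, hxy, hxy.symm, if_true, if_false] at hch ⊢
      by_cases h1 : a = x
      · subst h1
        simp only [hxy, hzx, if_true, if_false] at hch ⊢
        omega
      · by_cases h2 : a = F.par x
        · subst h2
          simp only [hzy, hxy, hxy.symm, if_true, if_false] at hch ⊢
          omega
        · simp only [h1, h2, if_false, Ne.symm h1, Ne.symm h2] at hch ⊢
          split_ifs at hch <;> omega
    · simp only [promote, hc, Function.update_apply, hxy, hxy.symm, if_true, if_false] at hch ⊢
      by_cases h2 : a = F.par x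
      · subst h2
        simp only [hzy, if_true, if_false] at hch ⊢
        omega
      · simp only [h2, if_false, Ne.symm h2] at hch ⊢
        split_ifs at hch <;> omega
  · have h1 := hF.ex_lt a ha
    have h2 := hF.ex_lt _ hym
    by_cases hax : a = x
    · subst hax
      have := promote_ex_self hF hx
      omega
    · by_cases hay : a = F.par x
      · rw [hay, promote_ex_par hF hx]; omega
      · rw [promote_ex_of_ne hax hay]; exact h1
  · rw [promote_ex_of_ne (by omega) hx.symm]
    exact hF.ex_zero

/-- Let `y` be the parent of `x` and `z` that of `y`. If `yz` is lighter than `xy`, then `x` and `y`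
are connected whenever `yz` survives the threshold, so `xz` can replace `yz`. Otherwise `yz`
survives whenever `xy` does, so `xz` can replace `xy`. -/
theorem promote_conn (hF : F.Inv n k) {x : ℕ} (hx : F.par x ≠ 0) (i : ℕ) :
    (F.promote x).Conn i = F.Conn i := by
  have hxy := hF.par_ne hx
  have old : ∀ a, i < F.wt a → F.Conn i a (F.par a) := fun a h => .rel _ _ ⟨rfl, h⟩
  have new : ∀ a, i < (F.promote x).wt a → (F.promote x).Conn i a ((F.promote x).par a) :=
    fun a h => .rel _ _ ⟨rfl, h⟩
  by_cases hc : F.wt (F.par x) < F.wt x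
  · have hp : (F.promote x).par = Function.update (Function.update F.par (F.par x) x) x
        (F.par (F.par x)) := by simp [promote, hc]
    have hw : (F.promote x).wt = Function.update (Function.update F.wt x (F.wt (F.par x)))
        (F.par x) (F.wt x) := by simp [promote, hc]
    ext a b
    constructor
    · refine eqvGen_le ?_
      rintro a _ ⟨rfl, hi⟩
      by_cases h1 : a = x
      · subst h1
        rw [hw] at hi
        simp only [Function.update_apply, hxy.symm, if_false, if_true] at hi
        rw [hp]
        simp only [Function.update_self]
        exact .trans _ _ _ (old a (by omega)) (old _ hi)
      · by_cases h2 : a = F.par x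
        · subst h2
          rw [hw] at hi
          simp only [Function.update_self] at hi
          rw [hp]
          simp only [Function.update_apply, hxy, if_false, if_true]
          exact .symm _ _ (old x hi)
        · rw [promote_par_of_ne h1 h2]
          rw [hw] at hi
          simp only [Function.update_apply, h1, h2, if_false] at hi
          exact old a hi
    · refine eqvGen_le ?_
      rintro a _ ⟨rfl, hi⟩
      have nx := new x
      have ny := new (F.par x)
      rw [hp, hw] at nx ny
      simp only [Function.update_apply, hxy, hxy.symm, if_false, if_true] at nx ny
      by_cases h1 : a = x
      · subst h1
        exact .symm _ _ (ny hi)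
      · by_cases h2 : a = F.par x
        · subst h2
          exact .trans _ _ _ (ny (by omega)) (nx hi)
        · have := new a
          rw [promote_par_of_ne h1 h2, hw] at this
          simp only [Function.update_apply, h1, h2, if_false] at this
          exact this hi
  · have hp : (F.promote x).par = Function.update F.par x (F.par (F.par x)) := by
      simp [promote, hc]
    have hw : (F.promote x).wt = F.wt := by simp [promote, hc]
    rw [hp, hw] at new
    ext a b
    constructor
    · refine eqvGen_le ?_
      rintro a _ ⟨rfl, hi⟩
      rw [hw] at hi
      rw [hp]
      by_cases h1 : a = x
      · subst h1
        simp only [Function.update_self]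
        exact .trans _ _ _ (old a hi) (old _ (by omega))
      · simp only [Function.update_apply, h1, if_false]
        exact old a hi
    · refine eqvGen_le ?_
      rintro a _ ⟨rfl, hi⟩
      have nx := new x
      have ny := new (F.par x)
      simp only [Function.update_apply, hxy, if_false, if_true] at nx ny
      by_cases h1 : a = x
      · subst h1
        exact .trans _ _ _ (nx hi) (.symm _ _ (ny (by omega)))
      · have := new a
        simp only [Function.update_apply, h1, if_false] at this
        exact this hi

/-! ### The potential -/

/-- The binary logarithm of the size of the subtree at `v`. -/
noncomputable def lsize (F : Forest) (v : ℕ) : ℝ := Real.logb 2 (F.ex v + 1)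

theorem lsize_nonneg (F : Forest) (v : ℕ) : 0 ≤ F.lsize v :=
  Real.logb_nonneg one_lt_two (by have : (0 : ℝ) ≤ F.ex v := Nat.cast_nonneg _; linarith)

/-- The sum of the logarithms of the subtree sizes. -/
noncomputable def pot (n : ℕ) (F : Forest) : ℝ := ∑ v ∈ Finset.Icc 1 n, F.lsize v

theorem pot_nonneg (n : ℕ) (F : Forest) : 0 ≤ F.pot n :=
  Finset.sum_nonneg fun v _ => F.lsize_nonneg v

theorem lsize_le_pot {v : ℕ} (hv : v ∈ Finset.Icc 1 n) : F.lsize v ≤ F.pot n :=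
  Finset.single_le_sum (fun v _ => F.lsize_nonneg v) hv

theorem lsize_mono {F F' : Forest} {a b : ℕ} (h : F.ex a ≤ F'.ex b) : F.lsize a ≤ F'.lsize b := by
  have : (F.ex a : ℝ) ≤ F'.ex b := by exact_mod_cast h
  exact Real.logb_le_logb_of_le one_lt_two (by positivity) (by linarith)

theorem lsize_add_one_le {F F' : Forest} {a b : ℕ} (h : 2 * (F.ex a + 1) ≤ F'.ex b + 1) :
    F.lsize a + 1 ≤ F'.lsize b := by
  have h' : (2 : ℝ) * (F.ex a + 1) ≤ F'.ex b + 1 := by exact_mod_cast h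
  have h1 : F.lsize a + 1 = Real.logb 2 (2 * (F.ex a + 1)) := by
    rw [Real.logb_mul (by norm_num) (by positivity)]
    simp [lsize, add_comm]
  rw [h1]
  exact Real.logb_le_logb_of_le one_lt_two (by positivity) h'

/-- A growth of the size by a factor of `3 / 2`, in the logarithmic scale. -/
theorem lsize_add_half_le {F F' : Forest} {a b : ℕ} (h : 3 * (F.ex a + 1) ≤ 2 * (F'.ex b + 1)) :
    F.lsize a + 1 / 2 ≤ F'.lsize b := by
  have h' : (3 : ℝ) * (F.ex a + 1) ≤ 2 * (F'.ex b + 1) := by exact_mod_cast h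
  -- Squaring turns the factor into `9 / 4 ≥ 2`, which is one full unit of the logarithm.
  have h2 : (2 : ℝ) * (F.ex a + 1) ^ 2 ≤ (F'.ex b + 1) ^ 2 := by
    have : (0 : ℝ) ≤ F.ex a := Nat.cast_nonneg _
    nlinarith
  have h3 := Real.logb_le_logb_of_le one_lt_two (by positivity) h2
  rw [Real.logb_mul (by norm_num) (by positivity), Real.logb_pow, Real.logb_pow,
    Real.logb_self_eq_one one_lt_two] at h3
  unfold lsize
  push_cast at h3
  linarith

theorem Inv.lsize_le (hF : F.Inv n k) {v : ℕ} (hv : v ∈ Finset.Icc 1 n) :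
    F.lsize v ≤ Nat.log 2 n + 1 := by
  have h1 : F.ex v + 1 ≤ 2 ^ (Nat.log 2 n + 1) :=
    (hF.ex_lt v hv).trans_le (Nat.lt_pow_succ_log_self one_lt_two n).le
  have h2 : (F.ex v + 1 : ℝ) ≤ 2 ^ (Nat.log 2 n + 1) := by exact_mod_cast h1
  have h3 := Real.logb_le_logb_of_le one_lt_two (by positivity) h2
  rw [Real.logb_pow, Real.logb_self_eq_one one_lt_two] at h3
  unfold lsize
  push_cast at h3
  linarith

/-- Roots are included: the dummy vertex `0` has no descendants, so its logarithmic size is `0`. -/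
theorem Inv.lsize_par_le (hF : F.Inv n k) (v : ℕ) : F.lsize (F.par v) ≤ Nat.log 2 n + 1 := by
  by_cases h : F.par v = 0
  · rw [h, lsize, hF.ex_zero]
    simp only [Nat.cast_zero, zero_add, Real.logb_one]
    positivity
  · exact hF.lsize_le (hF.par_mem h)

/-- Apart from `x`, only the old parent changes its subtree, and it loses that of `x`. -/
theorem pot_promote (hF : F.Inv n k) {x : ℕ} (hx : F.par x ≠ 0) :
    (F.promote x).pot n - (F.promote x).lsize x ≤ F.pot n - F.lsize x := by
  have h := sum_change_two (f := (F.promote x).lsize) (g := F.lsize) (hF.mem hx) (hF.par_mem hx)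
    (hF.par_ne hx).symm (fun a h1 h2 => by simp only [lsize, promote_ex_of_ne h1 h2])
  have h2 : (F.promote x).lsize (F.par x) ≤ F.lsize (F.par x) :=
    lsize_mono (by rw [promote_ex_par hF hx]; omega)
  unfold pot
  linarith

/-- The old parent keeps its subtree without that of `x`, which is less than half of the old subtree
of `x`, and `x` gets at most the old size of the parent. So the two sizes are, after an exchange of
roles, no larger, and one of them is halved. -/
theorem pot_promote_heavy (hF : F.Inv n k) {x : ℕ} (hx : F.par x ≠ 0)
    (h : 2 * (F.ex (F.par x) + 1) < 3 * (F.ex x + 1)) :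
    (F.promote x).pot n + 1 ≤ F.pot n := by
  have hlt := hF.ex_lt_par hx
  have hc := sum_change_two (f := (F.promote x).lsize) (g := F.lsize) (hF.mem hx) (hF.par_mem hx)
    (hF.par_ne hx).symm (fun a h1 h2 => by simp only [lsize, promote_ex_of_ne h1 h2])
  have h2 : (F.promote x).lsize (F.par x) + 1 ≤ F.lsize x :=
    lsize_add_one_le (by rw [promote_ex_par hF hx]; omega)
  have h3 : (F.promote x).lsize x ≤ F.lsize (F.par x) :=
    lsize_mono (by have := promote_ex_self hF hx; omega)
  unfold pot
  linarith

/-! ### Adding an edge between two vertices, one of them a root, the other a root or its child -/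

/-- Make `u` a child of `v`, with weight `k + 1`. -/
def link (F : Forest) (u v k : ℕ) : Forest :=
  ⟨Function.update F.par u v, Function.update F.wt u (k + 1),
    if F.par u = 0 then Function.update F.ex v (F.ex v + F.ex u + 1) else F.ex⟩

/-- Double counting: summing `ex_eq` over all vertices collects the subtree sizes of the non-roots,
while the total of all subtree sizes exceeds the total of `ex` by `n`. This keeps `ex_lt` true when
two trees are merged. -/
theorem Inv.sum_roots (hF : F.Inv n k) :
    ∑ x ∈ Finset.Icc 1 n, (if F.par x = 0 then F.ex x + 1 else 0) = n := by
  have h1 : ∑ y ∈ Finset.Icc 1 n, F.ex y =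
      ∑ x ∈ Finset.Icc 1 n, if F.par x = 0 then 0 else F.ex x + 1 := by
    rw [Finset.sum_congr rfl hF.ex_eq, Finset.sum_comm]
    refine Finset.sum_congr rfl fun x _ => ?_
    rw [Finset.sum_ite_eq]
    have := hF.par_le x
    simp only [Finset.mem_Icc]
    split_ifs <;> omega
  have h2 : ∑ x ∈ Finset.Icc 1 n, ((if F.par x = 0 then F.ex x + 1 else 0) +
      if F.par x = 0 then 0 else F.ex x + 1) = ∑ x ∈ Finset.Icc 1 n, (F.ex x + 1) :=
    Finset.sum_congr rfl fun x _ => by split_ifs <;> omega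
  rw [Finset.sum_add_distrib, Finset.sum_add_distrib, ← h1] at h2
  simp at h2
  omega

theorem Inv.roots_le (hF : F.Inv n k) {u v : ℕ} (hu : u ∈ Finset.Icc 1 n)
    (hv : v ∈ Finset.Icc 1 n) (huv : u ≠ v) (hpu : F.par u = 0) (hpv : F.par v = 0) :
    F.ex v + F.ex u + 1 < n := by
  have h := hF.sum_roots
  have hv' : v ∈ (Finset.Icc 1 n).erase u := Finset.mem_erase.2 ⟨huv.symm, hv⟩
  rw [← Finset.add_sum_erase _ _ hu, ← Finset.add_sum_erase _ _ hv', if_pos hpu, if_pos hpv] at h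
  omega

theorem link_inv (hF : F.Inv n k) {u v : ℕ} (hu : u ∈ Finset.Icc 1 n) (hv : v ∈ Finset.Icc 1 n)
    (huv : u ≠ v) (hpv : F.par v = 0) (hpu : F.par u = 0 ∨ F.par u = v) :
    (F.link u v k).Inv n (k + 1) := by
  have hui := Finset.mem_Icc.1 hu
  have hvi := Finset.mem_Icc.1 hv
  refine ⟨fun a => ?_, fun a ha => ?_, fun a => ?_, fun a => ?_, fun a ha => ?_, fun a ha => ?_,
    ?_⟩
  · have := hF.par_le a
    simp only [link, Function.update_apply]
    split_ifs <;> omega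
  · have := hF.par_out a ha
    simp only [link, Function.update_apply]
    split_ifs <;> omega
  · have := hF.wt_iff a
    simp only [link, Function.update_apply]
    split_ifs
    · exact iff_of_false (by simp) (by omega)
    · exact this
  · have := hF.wt_le a
    simp only [link, Function.update_apply]
    split_ifs <;> omega
  · by_cases h0 : F.par u = 0
    · have hch := sum_change_two (f := fun b => if (F.link u v k).par b = a then
        (F.link u v k).ex b + 1 else 0) (g := fun b => if F.par b = a then F.ex b + 1 else 0)
        hu hv huv (fun b h1 h2 => by simp [link, h0, h1, h2])
      rw [← hF.ex_eq a ha] at hch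
      generalize (∑ b ∈ Finset.Icc 1 n, if (F.link u v k).par b = a then
        (F.link u v k).ex b + 1 else 0) = T at hch ⊢
      have ha' := Finset.mem_Icc.1 ha
      simp only [link, h0, if_true, Function.update_apply, huv, huv.symm, if_false, hpv] at hch ⊢
      by_cases hav : a = v
      · subst hav
        simp only [if_true] at hch ⊢
        split_ifs at hch <;> omega
      · simp only [hav, Ne.symm hav, if_false] at hch ⊢
        split_ifs at hch <;> omega
    -- Here `u` is a child of `v` already, and only its weight changes.
    · have hp : F.par u = v := by omega
      have : (F.link u v k).par = F.par := by
        simp only [link]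
        rw [← hp, Function.update_eq_self]
      rw [this]
      simp only [link, h0, if_false]
      exact hF.ex_eq a ha
  · have h1 := hF.ex_lt a ha
    simp only [link]
    split_ifs with h0
    · have := hF.roots_le hu hv huv h0 hpv
      by_cases hav : a = v
      · subst hav
        simpa using this
      · simpa [hav] using h1
    · exact h1
  · have hv0 : 0 ≠ v := by omega
    simp only [link]
    split_ifs
    · simpa [hv0] using hF.ex_zero
    · exact hF.ex_zero

/-- The weight of the edge between a child of a root and the root is the bottleneck. -/
theorem Inv.conn_iff (hF : F.Inv n k) {u v i : ℕ} (hu : u ≠ 0) (huv : u ≠ v) (hpv : F.par v = 0)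
    (hpu : F.par u = 0 ∨ F.par u = v) : F.Conn i u v ↔ i < F.wt u := by
  constructor
  · intro h
    by_contra hi
    -- The only edge leaving the subtree of `u` is the one above `u`; if it is below the threshold,
    -- membership in this subtree is constant on the connectivity classes. It holds for `u` but not
    -- for the root `v`.
    have key : ∀ a b, F.Conn i a b → ((∃ t, F.par^[t] a = u) ↔ ∃ t, F.par^[t] b = u) := by
      intro a b hab
      induction hab with
      | rel a b h' =>
        obtain ⟨rfl, h'⟩ := h'
        constructor
        · rintro ⟨t, ht⟩
          cases t with
          | zero =>
            rw [Function.iterate_zero_apply] at ht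
            rw [ht] at h'
            exact absurd h' hi
          | succ t => exact ⟨t, ht⟩
        · rintro ⟨t, ht⟩
          exact ⟨t + 1, ht⟩
      | refl a => exact Iff.rfl
      | symm a b _ ih => exact ih.symm
      | trans a b c _ _ ih₁ ih₂ => exact ih₁.trans ih₂
    obtain ⟨t, ht⟩ := (key u v h).1 ⟨0, rfl⟩
    cases t with
    | zero => exact huv ht.symm
    | succ t =>
      rw [Function.iterate_succ_apply, hpv, Function.iterate_fixed hF.par_zero] at ht
      exact hu ht.symm
  · intro hi
    refine .rel _ _ ⟨?_, hi⟩
    rcases hpu with h | h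
    · rw [(hF.wt_iff u).2 h] at hi
      omega
    · exact h

/-- An overwritten edge above `u` also led to `v` and had weight at most `k`, so the new one of
weight `k + 1` survives every threshold that the old one did. -/
theorem link_conn (hF : F.Inv n k) {u v : ℕ} (hpu : F.par u = 0 ∨ F.par u = v) (i a b : ℕ) :
    (F.link u v k).Conn i a b ↔
      Relation.EqvGen (fun a b => F.Conn i a b ∨ (i ≤ k ∧ a = u ∧ b = v)) a b := by
  constructor
  · refine eqvGen_le ?_
    rintro a _ ⟨rfl, hi⟩
    apply Relation.EqvGen.rel
    by_cases h : a = u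
    · subst h
      simp only [link, Function.update_self] at hi ⊢
      exact .inr ⟨by omega, by trivial, by trivial⟩
    · simp only [link, Function.update_apply, h, if_false] at hi ⊢
      exact .inl (.rel _ _ ⟨by simp, hi⟩)
  · refine eqvGen_le ?_
    rintro a b (h | ⟨hi, rfl, rfl⟩)
    · refine eqvGen_le ?_ h
      rintro a _ ⟨rfl, hi⟩
      apply Relation.EqvGen.rel
      by_cases h : a = u
      · subst h
        have hk := hF.wt_le a
        have h0 : F.par a ≠ 0 := fun h => by rw [(hF.wt_iff a).2 h] at hi; omega
        simp only [link, Function.update_self]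
        exact ⟨by omega, by omega⟩
      · exact ⟨by simp [link, h], by simpa [link, h] using hi⟩
    · apply Relation.EqvGen.rel
      simp only [link, Function.update_self]
      exact ⟨trivial, by omega⟩

/-- Because `v` is a root, only the subtree of `v` can grow, and its logarithmic size is bounded by
`Inv.lsize_le`. -/
theorem pot_link (hF : F.Inv n k) {u v : ℕ} (hu : u ∈ Finset.Icc 1 n) (hv : v ∈ Finset.Icc 1 n)
    (huv : u ≠ v) (hpv : F.par v = 0) (hpu : F.par u = 0 ∨ F.par u = v) :
    (F.link u v k).pot n ≤ F.pot n + Nat.log 2 n + 1 := by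
  have hc := sum_change_two (f := (F.link u v k).lsize) (g := F.lsize) hu hv huv
    (fun a h1 h2 => by
      simp only [lsize, link]
      split_ifs
      · simp [h2]
      · rfl)
  have h1 := (link_inv hF hu hv huv hpv hpu).lsize_le hv
  have h2 : (F.link u v k).lsize u ≤ F.lsize u := lsize_mono (by
    simp only [link]
    split_ifs
    · simp [huv]
    · rfl)
  have h3 := F.lsize_nonneg v
  unfold pot
  linarith

end Forest

namespace RAM

/-! ## Reasoning about programs -/

/-- Assignment to a register. -/
def State.setReg (σ : State) (x v : ℕ) : State := ⟨Function.update σ.reg x v, σ.mem⟩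

/-- Assignment to a memory cell. -/
def State.setMem (σ : State) (a v : ℕ) : State := ⟨σ.reg, Function.update σ.mem a v⟩

theorem State.setReg_reg (σ : State) (x v y : ℕ) :
    (σ.setReg x v).reg y = if y = x then v else σ.reg y := Function.update_apply ..

theorem State.setReg_mem (σ : State) (x v : ℕ) : (σ.setReg x v).mem = σ.mem := rfl

theorem State.setMem_reg (σ : State) (a v : ℕ) : (σ.setMem a v).reg = σ.reg := rfl

theorem State.setMem_mem (σ : State) (a v b : ℕ) :
    (σ.setMem a v).mem b = if b = a then v else σ.mem b := Function.update_apply ..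

variable {S W : ℕ} {σ σ₁ σ₂ σ₃ : State}

theorem eval_lit {c : ℕ} (h : c < W) : (Expr.lit c).eval S W σ = some c := by
  simp [Expr.eval, word, h]

theorem eval_reg {x v : ℕ} (hv : σ.reg x = v) (h : v < W) :
    (Expr.reg x).eval S W σ = some v := by
  simp [Expr.eval, word, hv, h]

theorem eval_load {e : Expr} {a v : ℕ} (he : e.eval S W σ = some a) (ha : a < S)
    (hv : σ.mem a = v) (h : v < W) : (Expr.load e).eval S W σ = some v := by
  simp [Expr.eval, word, he, ha, hv, h]

theorem eval_bin {op : Op} {e f : Expr} {a b v : ℕ} (he : e.eval S W σ = some a)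
    (hf : f.eval S W σ = some b) (hv : op.apply a b = some v) (h : v < W) :
    (Expr.bin op e f).eval S W σ = some v := by
  simp [Expr.eval, word, he, hf, hv, h]

theorem eval_add {e f : Expr} {a b : ℕ} (he : e.eval S W σ = some a)
    (hf : f.eval S W σ = some b) (h : a + b < W) :
    (Expr.bin .add e f).eval S W σ = some (a + b) := eval_bin he hf rfl h

theorem eval_sub {e f : Expr} {a b : ℕ} (he : e.eval S W σ = some a)
    (hf : f.eval S W σ = some b) (h : a - b < W) :
    (Expr.bin .sub e f).eval S W σ = some (a - b) := eval_bin he hf rfl h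

theorem eval_mul {e f : Expr} {a b : ℕ} (he : e.eval S W σ = some a)
    (hf : f.eval S W σ = some b) (h : a * b < W) :
    (Expr.bin .mul e f).eval S W σ = some (a * b) := eval_bin he hf rfl h

theorem eval_lt {e f : Expr} {a b : ℕ} (he : e.eval S W σ = some a)
    (hf : f.eval S W σ = some b) (h : 1 < W) :
    (Expr.bin .lt e f).eval S W σ = some (if a < b then 1 else 0) :=
  eval_bin he hf rfl (by split_ifs <;> omega)

theorem eval_eq {e f : Expr} {a b : ℕ} (he : e.eval S W σ = some a)
    (hf : f.eval S W σ = some b) (h : 1 < W) :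
    (Expr.bin .eq e f).eval S W σ = some (if a = b then 1 else 0) :=
  eval_bin he hf rfl (by split_ifs <;> omega)

/-- `p` leads from `σ` to `σ'` in at most `T` steps. -/
def Runs (S W : ℕ) (p : Prog) (σ : State) (T : ℕ) (σ' : State) : Prop :=
  ∃ t ≤ T, Exec S W p σ t σ'

theorem Runs.mono {p : Prog} {T T' : ℕ} (h : Runs S W p σ₁ T σ₂) (hT : T ≤ T') :
    Runs S W p σ₁ T' σ₂ := by
  obtain ⟨t, ht, he⟩ := h
  exact ⟨t, ht.trans hT, he⟩

theorem Runs.skip : Runs S W .skip σ 1 σ := ⟨1, le_rfl, .skip σ⟩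

theorem Runs.set {x v : ℕ} {e : Expr} (he : e.eval S W σ = some v) :
    Runs S W (.set x e) σ (e.cost + 1) (σ.setReg x v) := ⟨_, le_rfl, .set σ x e v he⟩

theorem Runs.store {d e : Expr} {a v : ℕ} (hd : d.eval S W σ = some a) (ha : a < S)
    (he : e.eval S W σ = some v) :
    Runs S W (.store d e) σ (d.cost + e.cost + 1) (σ.setMem a v) :=
  ⟨_, le_rfl, .store σ d e a v hd ha he⟩

theorem Runs.seq {p q : Prog} {s t : ℕ} (hp : Runs S W p σ₁ s σ₂) (hq : Runs S W q σ₂ t σ₃) :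
    Runs S W (.seq p q) σ₁ (s + t) σ₃ := by
  obtain ⟨s', hs, hp⟩ := hp
  obtain ⟨t', ht, hq⟩ := hq
  exact ⟨_, Nat.add_le_add hs ht, .seq _ _ _ _ _ _ _ hp hq⟩

theorem Runs.ite_true {e : Expr} {p q : Prog} {v t : ℕ} (he : e.eval S W σ = some v)
    (hv : v ≠ 0) (hp : Runs S W p σ t σ₂) : Runs S W (.ite e p q) σ (e.cost + t + 1) σ₂ := by
  obtain ⟨t', ht, hp⟩ := hp
  exact ⟨_, by omega, .ite_true _ _ _ _ _ _ _ he hv hp⟩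

theorem Runs.ite_false {e : Expr} {p q : Prog} {t : ℕ} (he : e.eval S W σ = some 0)
    (hp : Runs S W q σ t σ₂) : Runs S W (.ite e p q) σ (e.cost + t + 1) σ₂ := by
  obtain ⟨t', ht, hp⟩ := hp
  exact ⟨_, by omega, .ite_false _ _ _ _ _ _ he hp⟩

/-- A loop whose iterations are paid for by a potential. -/
theorem exec_loop {e : Expr} {p : Prog} (I : State → Prop) (v : State → ℕ) (φ : State → ℝ)
    (hφ : ∀ σ, I σ → 0 ≤ φ σ) (hv : ∀ σ, I σ → e.eval S W σ = some (v σ))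
    (hp : ∀ σ, I σ → v σ ≠ 0 →
      ∃ t σ', Exec S W p σ t σ' ∧ I σ' ∧ φ σ' + (e.cost + t + 1 : ℕ) ≤ φ σ)
    (σ : State) (hσ : I σ) :
    ∃ t σ', Exec S W (.loop e p) σ t σ' ∧ I σ' ∧ v σ' = 0 ∧ φ σ' + t ≤ φ σ + (e.cost + 1 : ℕ) := by
  -- Every iteration takes at least one step and so lowers `φ` by at least one; hence `N` bounds the
  -- number of iterations.
  obtain ⟨N, hN⟩ := exists_nat_ge (φ σ)
  induction N generalizing σ with
  | zero =>
    by_cases h0 : v σ = 0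
    · exact ⟨_, σ, .loop_false σ e p (by rw [hv σ hσ, h0]), hσ, h0, le_rfl⟩
    · obtain ⟨t, σ', -, hI, ht⟩ := hp σ hσ h0
      have := hφ σ' hI
      have h0 : (0 : ℝ) ≤ t := Nat.cast_nonneg _
      have h1 : (0 : ℝ) ≤ e.cost := Nat.cast_nonneg _
      push_cast at ht hN
      linarith
  | succ N ih =>
    by_cases h0 : v σ = 0
    · exact ⟨_, σ, .loop_false σ e p (by rw [hv σ hσ, h0]), hσ, h0, le_rfl⟩
    · obtain ⟨t, σ', he, hI, ht⟩ := hp σ hσ h0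
      have h0' : (0 : ℝ) ≤ t := Nat.cast_nonneg _
      have h1 : (0 : ℝ) ≤ e.cost := Nat.cast_nonneg _
      push_cast at ht hN
      obtain ⟨t', σ'', he', hI', hv', ht'⟩ := ih σ' hI (by linarith)
      refine ⟨_, σ'', .loop_true _ _ _ _ _ _ _ _ (hv σ hσ) h0 he he', hI', hv', ?_⟩
      push_cast at ht' ⊢
      linarith

/-! ## Forests in memory -/

/-- The memory and word limits suffice for a linear number of cells and linear values. -/
structure Limits (n m S W : ℕ) : Prop where
  space : 8 * m + 4 * n + 10 ≤ S
  word : 100 * (n + m + 2) ≤ W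

/-- The address of the field `c` of the vertex `e`; register `6` holds the base address. -/
def fieldAddr (c : ℕ) (e : Expr) : Expr :=
  .bin .add (.bin .add (.reg 6) (.bin .mul (.lit 4) e)) (.lit c)

/-- The field `c` of the vertex `e`. -/
def field (c : ℕ) (e : Expr) : Expr := .load (fieldAddr c e)

/-- The contents of the field `c` of the vertex `v`. -/
def fld (m : ℕ) (σ : State) (c v : ℕ) : ℕ := σ.mem (8 * m + 6 + 4 * v + c)

/-- The forest stored in memory. -/
def forestOf (m : ℕ) (σ : State) : Forest := ⟨fld m σ 0, fld m σ 1, fld m σ 2⟩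

theorem fld_setReg (m : ℕ) (σ : State) (x v : ℕ) : fld m (σ.setReg x v) = fld m σ := rfl

/-- Assignment to the field `c` of the vertex `x`. -/
def State.setField (σ : State) (m c x w : ℕ) : State := σ.setMem (8 * m + 6 + 4 * x + c) w

theorem State.setField_reg (σ : State) (m c x w : ℕ) : (σ.setField m c x w).reg = σ.reg := rfl

/-- The cells below `8 * m + 6` hold the input (`2 * m` cells) and three sets of `m + 1` points; the
vertex records, four cells each, come after them. -/
theorem State.setField_mem (σ : State) {m : ℕ} (c x w : ℕ) {a : ℕ} (ha : a < 8 * m + 6) :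
    (σ.setField m c x w).mem a = σ.mem a := by
  rw [State.setField, State.setMem_mem, if_neg (by omega)]

theorem fld_setField (m : ℕ) (σ : State) {c c' : ℕ} (x w v : ℕ) (hc : c < 4) (hc' : c' < 4) :
    fld m (σ.setField m c x w) c' v =
      if c' = c then (if v = x then w else fld m σ c' v) else fld m σ c' v := by
  unfold fld
  rw [State.setField, State.setMem_mem]
  split_ifs <;> first | rfl | omega

variable {n m : ℕ}

theorem eval_fieldAddr (hL : Limits n m S W) (h6 : σ.reg 6 = 8 * m + 6) {e : Expr} {v c : ℕ}
    (he : e.eval S W σ = some v) (hv : v ≤ n) (hc : c < 4) :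
    (fieldAddr c e).eval S W σ = some (8 * m + 6 + 4 * v + c) := by
  have := hL.word
  exact eval_add (eval_add (eval_reg h6 (by omega)) (eval_mul (eval_lit (by omega)) he (by omega))
    (by omega)) (eval_lit (by omega)) (by omega)

theorem eval_field (hL : Limits n m S W) (h6 : σ.reg 6 = 8 * m + 6) {e : Expr} {v c : ℕ}
    (he : e.eval S W σ = some v) (hv : v ≤ n) (hc : c < 4) (hb : fld m σ c v ≤ n + m) :
    (field c e).eval S W σ = some (fld m σ c v) := by
  have := hL.word
  have := hL.space
  exact eval_load (eval_fieldAddr hL h6 he hv hc) (by omega) rfl (by omega)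

theorem Runs.storeField (hL : Limits n m S W) (h6 : σ.reg 6 = 8 * m + 6) {d e : Expr}
    {v w c : ℕ} (hd : d.eval S W σ = some v) (hv : v ≤ n) (hc : c < 4)
    (he : e.eval S W σ = some w) :
    Runs S W (.store (fieldAddr c d) e) σ (d.cost + e.cost + 7)
      (σ.setField m c v w) := by
  have := hL.space
  refine (Runs.store (eval_fieldAddr hL h6 hd hv hc) (by omega) he).mono ?_
  simp only [fieldAddr, Expr.cost]
  omega

/-- The part of the state that programs working on the forest leave unchanged. -/
structure Frame (m : ℕ) (σ σ' : State) : Prop where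
  reg : ∀ r ≤ 10, σ'.reg r = σ.reg r
  mem : ∀ a < 8 * m + 6, σ'.mem a = σ.mem a
  last : ∀ v, fld m σ' 3 v = fld m σ 3 v

theorem Frame.refl (m : ℕ) (σ : State) : Frame m σ σ :=
  ⟨fun _ _ => rfl, fun _ _ => rfl, fun _ => rfl⟩

theorem Frame.trans (h₁ : Frame m σ₁ σ₂) (h₂ : Frame m σ₂ σ₃) : Frame m σ₁ σ₃ :=
  ⟨fun r hr => (h₂.reg r hr).trans (h₁.reg r hr), fun a ha => (h₂.mem a ha).trans (h₁.mem a ha),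
    fun v => (h₂.last v).trans (h₁.last v)⟩

theorem Frame.setReg (m : ℕ) (σ : State) {x : ℕ} (hx : 10 < x) (v : ℕ) :
    Frame m σ (σ.setReg x v) := by
  refine ⟨fun r hr => ?_, fun _ _ => rfl, fun _ => rfl⟩
  rw [State.setReg_reg, if_neg (by omega)]

/-- Load the data of the vertex in register `11` and of its parent. -/
def loadProg : Prog :=
  .seq (.set 12 (field 0 (.reg 11))) <|
  .seq (.set 13 (field 0 (.reg 12))) <|
  .seq (.set 14 (field 1 (.reg 11))) <|
  .seq (.set 15 (field 1 (.reg 12))) <|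
  .seq (.set 16 (field 2 (.reg 11))) <|
  .set 17 (field 2 (.reg 12))

/-- Promote the vertex in register `11`. -/
def promoteProg : Prog :=
  .seq loadProg <|
  .ite (.bin .lt (.reg 15) (.reg 14))
    (.seq (.store (fieldAddr 0 (.reg 12)) (.reg 11)) <|
    .seq (.store (fieldAddr 0 (.reg 11)) (.reg 13)) <|
    .seq (.store (fieldAddr 1 (.reg 11)) (.reg 15)) <|
    .seq (.store (fieldAddr 1 (.reg 12)) (.reg 14)) <|
    .seq (.store (fieldAddr 2 (.reg 12)) (.bin .sub (.bin .sub (.reg 17) (.reg 16)) (.lit 1))) <|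
    .store (fieldAddr 2 (.reg 11)) (.reg 17))
    (.seq (.store (fieldAddr 0 (.reg 11)) (.reg 13)) <|
    .store (fieldAddr 2 (.reg 12)) (.bin .sub (.bin .sub (.reg 17) (.reg 16)) (.lit 1)))

/-- All data are read before the first store, so the later stores cannot affect them. The record of
vertex `0` stays zero, so parents of roots may be read as well. -/
theorem runs_load (hL : Limits n m S W) (h6 : σ.reg 6 = 8 * m + 6) {k x : ℕ} (hk : k ≤ m)
    (hF : (forestOf m σ).Inv n k) (hx : σ.reg 11 = x) (hpx : (forestOf m σ).par x ≠ 0) :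
    Runs S W loadProg σ 54 ((((((σ.setReg 12 ((forestOf m σ).par x)).setReg 13
      ((forestOf m σ).par ((forestOf m σ).par x))).setReg 14 ((forestOf m σ).wt x)).setReg 15
      ((forestOf m σ).wt ((forestOf m σ).par x))).setReg 16 ((forestOf m σ).ex x)).setReg 17
      ((forestOf m σ).ex ((forestOf m σ).par x))) := by
  have hW := hL.word
  have hxi := Finset.mem_Icc.1 (hF.mem hpx)
  have hyi := Finset.mem_Icc.1 (hF.par_mem hpx)
  have hz := hF.par_le ((forestOf m σ).par x)
  have hwx := hF.wt_le x
  have hwy := hF.wt_le ((forestOf m σ).par x)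
  have hex := hF.ex_lt _ (hF.mem hpx)
  have hey := hF.ex_lt _ (hF.par_mem hpx)
  refine Runs.mono (.seq (.set (eval_field hL ?_ (eval_reg ?_ ?_) ?_ ?_ ?_)) <|
    .seq (.set (eval_field hL ?_ (eval_reg ?_ ?_) ?_ ?_ ?_)) <|
    .seq (.set (eval_field hL ?_ (eval_reg ?_ ?_) ?_ ?_ ?_)) <|
    .seq (.set (eval_field hL ?_ (eval_reg ?_ ?_) ?_ ?_ ?_)) <|
    .seq (.set (eval_field hL ?_ (eval_reg ?_ ?_) ?_ ?_ ?_)) <|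
    (.set (eval_field hL ?_ (eval_reg ?_ ?_) ?_ ?_ ?_))) ?_
  all_goals first
    | (simp only [State.setReg_reg]; exact h6)
    | (simp only [State.setReg_reg]; exact hx)
    | (simp only [State.setReg_reg]; rfl)
    | (simp only [fld_setReg, forestOf] at hxi hyi hz hwx hwy hex hey ⊢; omega)
    | decide

theorem exec_promote (hL : Limits n m S W) (h6 : σ.reg 6 = 8 * m + 6) {k x : ℕ} (hk : k ≤ m)
    (hF : (forestOf m σ).Inv n k) (hx : σ.reg 11 = x) (hpx : (forestOf m σ).par x ≠ 0) :
    ∃ σ', Runs S W promoteProg σ 150 σ' ∧ Frame m σ σ' ∧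
      forestOf m σ' = (forestOf m σ).promote x := by
  have hload := runs_load hL h6 hk hF hx hpx
  have hW := hL.word
  have hxi := Finset.mem_Icc.1 (hF.mem hpx)
  have hyi := Finset.mem_Icc.1 (hF.par_mem hpx)
  have hz := hF.par_le ((forestOf m σ).par x)
  have hwx := hF.wt_le x
  have hwy := hF.wt_le ((forestOf m σ).par x)
  have hex := hF.ex_lt _ (hF.mem hpx)
  have hey := hF.ex_lt _ (hF.par_mem hpx)
  have hxy := hF.par_ne hpx
  generalize hτ : ((((((σ.setReg 12 ((forestOf m σ).par x)).setReg 13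
      ((forestOf m σ).par ((forestOf m σ).par x))).setReg 14 ((forestOf m σ).wt x)).setReg 15
      ((forestOf m σ).wt ((forestOf m σ).par x))).setReg 16 ((forestOf m σ).ex x)).setReg 17
      ((forestOf m σ).ex ((forestOf m σ).par x))) = τ at hload
  have t6 : τ.reg 6 = 8 * m + 6 := by simp [← hτ, State.setReg_reg, h6]
  have t11 : τ.reg 11 = x := by simp [← hτ, State.setReg_reg, hx]
  have t12 : τ.reg 12 = (forestOf m σ).par x := by simp [← hτ, State.setReg_reg]
  have t13 : τ.reg 13 = (forestOf m σ).par ((forestOf m σ).par x) := by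
    simp [← hτ, State.setReg_reg]
  have t14 : τ.reg 14 = (forestOf m σ).wt x := by simp [← hτ, State.setReg_reg]
  have t15 : τ.reg 15 = (forestOf m σ).wt ((forestOf m σ).par x) := by
    simp [← hτ, State.setReg_reg]
  have t16 : τ.reg 16 = (forestOf m σ).ex x := by simp [← hτ, State.setReg_reg]
  have t17 : τ.reg 17 = (forestOf m σ).ex ((forestOf m σ).par x) := by
    simp [← hτ, State.setReg_reg]
  have tr : ∀ r ≤ 10, τ.reg r = σ.reg r := by
    intro r hr
    simp only [← hτ, State.setReg_reg]
    repeat rw [if_neg (by omega)]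
  have tm : τ.mem = σ.mem := by simp [← hτ, State.setReg_mem]
  have tf : ∀ c, fld m τ c = fld m σ c := fun c => by simp [← hτ, fld_setReg]
  clear hτ
  by_cases hc : (forestOf m σ).wt ((forestOf m σ).par x) < (forestOf m σ).wt x
  · refine ⟨_, Runs.mono (hload.seq (.ite_true (eval_lt (eval_reg (by exact t15) (by omega))
      (eval_reg (by exact t14) (by omega)) (by omega)) (by simp [hc])
      (.seq (.storeField (c := 0) hL (by exact t6) (eval_reg (by exact t12) (by omega)) (by omega) (by omega)
        (eval_reg (by exact t11) (by omega))) <|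
      .seq (.storeField (c := 0) hL (by exact t6) (eval_reg (by exact t11) (by omega)) (by omega) (by omega)
        (eval_reg (by exact t13) (by omega))) <|
      .seq (.storeField (c := 1) hL (by exact t6) (eval_reg (by exact t11) (by omega)) (by omega) (by omega)
        (eval_reg (by exact t15) (by omega))) <|
      .seq (.storeField (c := 1) hL (by exact t6) (eval_reg (by exact t12) (by omega)) (by omega) (by omega)
        (eval_reg (by exact t14) (by omega))) <|
      .seq (.storeField (c := 2) hL (by exact t6) (eval_reg (by exact t12) (by omega)) (by omega) (by omega)
        (eval_sub (eval_sub (eval_reg (by exact t17) (by omega)) (eval_reg (by exact t16) (by omega)) (by omega))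
          (eval_lit (by omega)) (by omega))) <|
      .storeField (c := 2) hL (by exact t6) (eval_reg (by exact t11) (by omega)) (by omega) (by omega)
        (eval_reg (by exact t17) (by omega))))) (by decide), ⟨tr, ?_, ?_⟩, ?_⟩
    · intro a ha
      simp only [State.setField_mem _ _ _ _ ha, tm]
    · intro v
      simp [fld_setField, tf]
    · unfold Forest.promote
      rw [if_pos hc]
      ext v <;> simp [forestOf, fld_setField, tf, Function.update_apply]
  · refine ⟨_, Runs.mono (hload.seq (.ite_false (by
      rw [eval_lt (eval_reg (by exact t15) (by omega)) (eval_reg (by exact t14) (by omega)) (by omega), if_neg hc])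
      (.seq (.storeField (c := 0) hL (by exact t6) (eval_reg (by exact t11) (by omega)) (by omega) (by omega)
        (eval_reg (by exact t13) (by omega))) <|
      .storeField (c := 2) hL (by exact t6) (eval_reg (by exact t12) (by omega)) (by omega) (by omega)
        (eval_sub (eval_sub (eval_reg (by exact t17) (by omega)) (eval_reg (by exact t16) (by omega)) (by omega))
          (eval_lit (by omega)) (by omega))))) (by decide), ⟨tr, ?_, ?_⟩, ?_⟩
    · intro a ha
      simp only [State.setField_mem _ _ _ _ ha, tm]
    · intro v
      simp [fld_setField, tf]
    · unfold Forest.promote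
      rw [if_neg hc]
      ext v <;> simp [forestOf, fld_setField, tf, Function.update_apply]

end RAM

namespace RAM

variable {S W n m : ℕ} {σ σ₁ σ₂ σ₃ : State}

/-! ## Moving a vertex to the root -/

/-- The parent of a vertex. -/
def parE (e : Expr) : Expr := field 0 e

/-- Whether the parent of the vertex in register `10` has more than two thirds of the descendants of
the grandparent. -/
def heavyE : Expr :=
  .bin .lt (.bin .mul (.lit 2) (.bin .add (field 2 (parE (parE (.reg 10)))) (.lit 1)))
    (.bin .mul (.lit 3) (.bin .add (field 2 (parE (.reg 10))) (.lit 1)))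

/-- One step of moving the vertex in register `10` up. -/
def perchStep : Prog :=
  .seq (.ite heavyE (.set 11 (parE (.reg 10))) (.set 11 (.reg 10))) promoteProg

/-- Promote the vertex in register `10` if `e` is not zero. -/
def promoteIf (e : Expr) : Prog :=
  .ite e (.seq (.set 11 (.reg 10)) promoteProg) .skip

/-- Make the vertex in register `10` a root. -/
def perchProg : Prog :=
  .seq (.loop (parE (parE (parE (.reg 10)))) perchStep) <|
  .seq (promoteIf (parE (parE (.reg 10)))) (promoteIf (parE (.reg 10)))

theorem eval_parE (hL : Limits n m S W) (h6 : σ.reg 6 = 8 * m + 6) {k : ℕ}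
    (hF : (forestOf m σ).Inv n k) {e : Expr} {v : ℕ} (he : e.eval S W σ = some v) (hv : v ≤ n) :
    (parE e).eval S W σ = some ((forestOf m σ).par v) :=
  eval_field hL h6 he hv (by omega) ((hF.par_le v).trans (by omega))

theorem eval_ex (hL : Limits n m S W) (h6 : σ.reg 6 = 8 * m + 6) {k : ℕ}
    (hF : (forestOf m σ).Inv n k) {e : Expr} {v : ℕ} (he : e.eval S W σ = some v)
    (hv : v ∈ Finset.Icc 1 n) :
    (field 2 e).eval S W σ = some ((forestOf m σ).ex v) :=
  eval_field hL h6 he (Finset.mem_Icc.1 hv).2 (by omega) ((hF.ex_lt v hv).le.trans (by omega))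

/-- The part of the state that moving the vertex `u` up leaves unchanged, apart from the forest, and
the connectivity. -/
structure Moved (n m k : ℕ) (σ σ' : State) : Prop where
  frame : Frame m σ σ'
  inv : (forestOf m σ').Inv n k
  conn : ∀ i, (forestOf m σ').Conn i = (forestOf m σ).Conn i

theorem Moved.trans {k : ℕ} (h₁ : Moved n m k σ₁ σ₂) (h₂ : Moved n m k σ₂ σ₃) :
    Moved n m k σ₁ σ₃ :=
  ⟨h₁.frame.trans h₂.frame, h₂.inv, fun i => (h₂.conn i).trans (h₁.conn i)⟩

theorem runs_promote (hL : Limits n m S W) (h6 : σ.reg 6 = 8 * m + 6) {k x : ℕ} (hk : k ≤ m)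
    (hF : (forestOf m σ).Inv n k) (hx : σ.reg 11 = x) (hpx : (forestOf m σ).par x ≠ 0) :
    ∃ σ', Runs S W promoteProg σ 150 σ' ∧ Moved n m k σ σ' ∧
      forestOf m σ' = (forestOf m σ).promote x := by
  obtain ⟨σ', hr, hf, he⟩ := exec_promote hL h6 hk hF hx hpx
  exact ⟨σ', hr, ⟨hf, he ▸ Forest.promote_inv hF hpx,
    fun i => by rw [he, Forest.promote_conn hF hpx]⟩, he⟩

/-- The great-grandparent of `u` exists, so the promoted vertex has a grandparent in either case,
and no root is displaced. The final alternative is what pays for the step: a heavy parent, or a gain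
by a factor of `3 / 2`. -/
theorem exec_perchStep (hL : Limits n m S W) (h6 : σ.reg 6 = 8 * m + 6) {k u : ℕ} (hk : k ≤ m)
    (hF : (forestOf m σ).Inv n k) (hu : σ.reg 10 = u)
    (hpu : (forestOf m σ).par ((forestOf m σ).par ((forestOf m σ).par u)) ≠ 0) :
    ∃ σ' x, Runs S W perchStep σ 250 σ' ∧ Moved n m k σ σ' ∧
      forestOf m σ' = (forestOf m σ).promote x ∧ (forestOf m σ).par ((forestOf m σ).par x) ≠ 0 ∧
      ((x = (forestOf m σ).par u ∧ 2 * ((forestOf m σ).ex ((forestOf m σ).par x) + 1) <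
          3 * ((forestOf m σ).ex x + 1)) ∨
        (x = u ∧ 3 * ((forestOf m σ).ex ((forestOf m σ).par u) + 1) ≤
          2 * ((forestOf m σ).ex ((forestOf m σ).par ((forestOf m σ).par u)) + 1))) := by
  have hW := hL.word
  have h2 : (forestOf m σ).par ((forestOf m σ).par u) ≠ 0 := fun h => hpu (by
    rw [h, hF.par_zero])
  have h1 : (forestOf m σ).par u ≠ 0 := fun h => h2 (by rw [h, hF.par_zero])
  have hum := Finset.mem_Icc.1 (hF.mem h1)
  have hy := hF.par_mem h1
  have hz := hF.par_mem h2
  have hey := hF.ex_lt _ hy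
  have hez := hF.ex_lt _ hz
  have hyi := Finset.mem_Icc.1 hy
  have hzi := Finset.mem_Icc.1 hz
  have e0 : (Expr.reg 10).eval S W σ = some u := eval_reg hu (by omega)
  have e1 := eval_parE hL h6 hF e0 hum.2
  have e2 := eval_parE hL h6 hF e1 hyi.2
  have hh : heavyE.eval S W σ = some (if 2 * ((forestOf m σ).ex ((forestOf m σ).par
      ((forestOf m σ).par u)) + 1) < 3 * ((forestOf m σ).ex ((forestOf m σ).par u) + 1)
      then 1 else 0) := by
    refine eval_lt (eval_mul (eval_lit (by omega)) (eval_add (eval_ex hL h6 hF e2 hz)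
      (eval_lit (by omega)) (by omega)) (by omega)) (eval_mul (eval_lit (by omega)) (eval_add
      (eval_ex hL h6 hF e1 hy) (eval_lit (by omega)) (by omega)) (by omega)) (by omega)
  by_cases hc : 2 * ((forestOf m σ).ex ((forestOf m σ).par
      ((forestOf m σ).par u)) + 1) < 3 * ((forestOf m σ).ex ((forestOf m σ).par u) + 1)
  · rw [if_pos hc] at hh
    have hs := Runs.set (x := 11) e1
    obtain ⟨σ', hr, hm, he⟩ := runs_promote (σ := σ.setReg 11 ((forestOf m σ).par u)) hL
      (by simpa [State.setReg_reg] using h6) hk hF (by simp [State.setReg_reg]) h2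
    refine ⟨σ', _, Runs.mono ((Runs.ite_true hh one_ne_zero hs).seq hr) (by decide),
      ⟨(Frame.setReg m σ (by omega) _).trans hm.frame, hm.inv, hm.conn⟩, he, hpu, .inl ⟨rfl, hc⟩⟩
  · rw [if_neg hc] at hh
    have hs := Runs.set (x := 11) e0
    obtain ⟨σ', hr, hm, he⟩ := runs_promote (σ := σ.setReg 11 u) hL
      (by simpa [State.setReg_reg] using h6) hk hF (by simp [State.setReg_reg]) h1
    refine ⟨σ', _, Runs.mono ((Runs.ite_false hh hs).seq hr) (by decide),
      ⟨(Frame.setReg m σ (by omega) _).trans hm.frame, hm.inv, hm.conn⟩, he, h2, .inr ⟨rfl, ?_⟩⟩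
    omega

theorem exec_perchLoop (hL : Limits n m S W) (h6 : σ.reg 6 = 8 * m + 6) {k u : ℕ} (hk : k ≤ m)
    (hF : (forestOf m σ).Inv n k) (hu : σ.reg 10 = u) (hun : u ∈ Finset.Icc 1 n) :
    ∃ t σ', Exec S W (.loop (parE (parE (parE (.reg 10)))) perchStep) σ t σ' ∧
      Moved n m k σ σ' ∧
      (forestOf m σ').par ((forestOf m σ').par ((forestOf m σ').par u)) = 0 ∧
      (∀ a, (forestOf m σ).par a = 0 → (forestOf m σ').par a = 0) ∧
      t + 300 * (forestOf m σ').pot n ≤ 300 * (forestOf m σ).pot n + 930 * (Nat.log 2 n + 1) := by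
  have hW := hL.word
  have huni := Finset.mem_Icc.1 hun
  obtain ⟨t, σ', he, ⟨hm, ha⟩, hv, ht⟩ := exec_loop (S := S) (W := W)
    (e := parE (parE (parE (.reg 10)))) (p := perchStep)
    (fun τ => Moved n m k σ τ ∧ ∀ a, (forestOf m σ).par a = 0 → (forestOf m τ).par a = 0)
    (fun τ => (forestOf m τ).par ((forestOf m τ).par ((forestOf m τ).par u)))
    -- An iteration, with its test, costs at most `300`. A heavy step lowers the first term by
    -- `300`; a light one lowers the second term by `600 / 2`. Leaving out `u` itself keeps the
    -- first term from growing when `u` is promoted.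
    (fun τ => 300 * ((forestOf m τ).pot n - (forestOf m τ).lsize u) +
      600 * ((Nat.log 2 n + 1) - (forestOf m τ).lsize ((forestOf m τ).par u)))
    (by
      rintro τ ⟨hm, -⟩
      have h1 := Forest.lsize_le_pot (F := forestOf m τ) hun
      have h2 := hm.inv.lsize_par_le u
      linarith)
    (by
      rintro τ ⟨hm, -⟩
      have h6' : τ.reg 6 = 8 * m + 6 := (hm.frame.reg 6 (by omega)).trans h6
      have e0 : (Expr.reg 10).eval S W τ = some u :=
        eval_reg ((hm.frame.reg 10 (by omega)).trans hu) (by omega)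
      exact eval_parE hL h6' hm.inv (eval_parE hL h6' hm.inv (eval_parE hL h6' hm.inv e0 huni.2)
        (hm.inv.par_le _)) (hm.inv.par_le _))
    (by
      rintro τ ⟨hm, ha⟩ hv
      have h6' : τ.reg 6 = 8 * m + 6 := (hm.frame.reg 6 (by omega)).trans h6
      have hu' : τ.reg 10 = u := (hm.frame.reg 10 (by omega)).trans hu
      obtain ⟨τ', x, ⟨t, ht, he⟩, hm', hp, hx, hc⟩ := exec_perchStep hL h6' hk hm.inv hu' hv
      have hF' := hm.inv
      refine ⟨t, τ', he, ⟨hm.trans hm', ?_⟩, ?_⟩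
      · intro a h0
        have h1 := ha a h0
        rw [hp, Forest.promote_par_of_ne, h1]
        · rintro rfl
          exact hx (by rw [h1, hF'.par_zero])
        · rintro rfl
          exact hx h1
      · have ht' : (((parE (parE (parE (.reg 10)))).cost + t + 1 : ℕ) : ℝ) ≤ 300 := by
          have : (parE (parE (parE (.reg 10)))).cost = 22 := by decide
          rw [this]
          exact_mod_cast (by omega : 22 + t + 1 ≤ 300)
        have h2 : (forestOf m τ).par ((forestOf m τ).par u) ≠ 0 := fun h => hv (by
          rw [h, hF'.par_zero])
        have h1 : (forestOf m τ).par u ≠ 0 := fun h => h2 (by rw [h, hF'.par_zero])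
        rw [hp]
        rcases hc with ⟨rfl, hc⟩ | ⟨rfl, hc⟩
        -- Heavy case: `u` keeps its parent and its subtree, and the parent, which is promoted, does
        -- not lose size.
        · have hux := hF'.par_ne h1
          have huz := hF'.par_par_ne h1
          have hpot := Forest.pot_promote_heavy hF' h2 hc
          have hpar : ((forestOf m τ).promote ((forestOf m τ).par u)).par u =
              (forestOf m τ).par u := Forest.promote_par_of_ne hux.symm huz.symm
          have hls : ((forestOf m τ).promote ((forestOf m τ).par u)).lsize u =
              (forestOf m τ).lsize u := by
            simp only [Forest.lsize, Forest.promote_ex_of_ne hux.symm huz.symm]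
          have hly : (forestOf m τ).lsize ((forestOf m τ).par u) ≤
              ((forestOf m τ).promote ((forestOf m τ).par u)).lsize ((forestOf m τ).par u) := by
            refine Forest.lsize_mono ?_
            have h1 := hF'.ex_lt_par h2
            rcases Forest.promote_ex_self hF' h2 with h | h <;> omega
          rw [hpar, hls]
          linarith
        -- Light case: the new parent of `u` is its old grandparent, whose subtree size is
        -- unchanged.
        · have hpot := Forest.pot_promote hF' h1
          have hly : (forestOf m τ).lsize ((forestOf m τ).par x) + 1 / 2 ≤
              ((forestOf m τ).promote x).lsize ((forestOf m τ).par ((forestOf m τ).par x)) := by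
            refine Forest.lsize_add_half_le ?_
            rw [Forest.promote_ex_of_ne (hF'.par_par_ne h1) (hF'.par_ne h2)]
            exact hc
          rw [Forest.promote_par_self]
          linarith)
    σ ⟨⟨Frame.refl m σ, hF, fun _ => rfl⟩, fun _ h => h⟩
  -- The constant `930` consists of `300` for the final size of `u`, `600` for the initial second
  -- term, and a margin for the last test.
  refine ⟨t, σ', he, hm, hv, ha, ?_⟩
  have hcost : (parE (parE (parE (.reg 10)))).cost = 22 := by decide
  rw [hcost] at ht
  have h1 := hm.inv.lsize_le hun
  have h2 := hm.inv.lsize_par_le u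
  have h3 := (forestOf m σ).lsize_nonneg u
  have h4 := (forestOf m σ).lsize_nonneg ((forestOf m σ).par u)
  have h5 : (0 : ℝ) ≤ Nat.log 2 n := Nat.cast_nonneg _
  push_cast at ht
  linarith

theorem exec_promoteIf (hL : Limits n m S W) (h6 : σ.reg 6 = 8 * m + 6) {k u v : ℕ} (hk : k ≤ m)
    (hF : (forestOf m σ).Inv n k) (hu : σ.reg 10 = u) (hun : u ∈ Finset.Icc 1 n) {e : Expr}
    (hcost : e.cost ≤ 40) (he : e.eval S W σ = some v) (hv : v ≠ 0 → (forestOf m σ).par u ≠ 0) :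
    ∃ t σ', Exec S W (promoteIf e) σ t σ' ∧ Moved n m k σ σ' ∧
      forestOf m σ' = (if v = 0 then forestOf m σ else (forestOf m σ).promote u) ∧
      t + 300 * (forestOf m σ').pot n ≤ 300 * (forestOf m σ).pot n + 600 * (Nat.log 2 n + 1) := by
  have hW := hL.word
  have hui := Finset.mem_Icc.1 hun
  have h5 : (0 : ℝ) ≤ Nat.log 2 n := Nat.cast_nonneg _
  by_cases h0 : v = 0
  · subst h0
    obtain ⟨t, ht, hr⟩ := Runs.ite_false (p := .seq (.set 11 (.reg 10)) promoteProg) he Runs.skip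
    refine ⟨t, σ, hr, ⟨Frame.refl m σ, hF, fun _ => rfl⟩, by simp, ?_⟩
    have : (t : ℝ) ≤ 300 := by exact_mod_cast (by omega)
    linarith
  · obtain ⟨σ', hr, hm, hp⟩ := runs_promote (σ := σ.setReg 11 u) hL
      (by simpa [State.setReg_reg] using h6) hk hF (by simp [State.setReg_reg]) (hv h0)
    obtain ⟨t, ht, hr⟩ := Runs.ite_true (q := .skip) he h0
      ((Runs.set (x := 11) (eval_reg hu (by omega))).seq hr)
    refine ⟨t, σ', hr, ⟨(Frame.setReg m σ (by omega) _).trans hm.frame, hm.inv, hm.conn⟩,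
      by rw [if_neg h0]; exact hp, ?_⟩
    have hc : (Expr.reg 10).cost = 1 := rfl
    have : (t : ℝ) ≤ 300 := by exact_mod_cast (by omega)
    have h1 := hm.inv.lsize_le hun
    have h2 : (forestOf m σ').pot n - (forestOf m σ').lsize u ≤
        (forestOf m σ).pot n - (forestOf m σ).lsize u := by
      rw [hp]
      exact Forest.pot_promote hF (hv h0)
    have h3 := (forestOf m σ).lsize_nonneg u
    linarith

/-- After the loop, `u` has at most two proper ancestors. Only the last promotion can displace a
root, and this root then becomes a child of `u`. The constant is `930 + 2 * 600`. -/
theorem exec_perch (hL : Limits n m S W) (h6 : σ.reg 6 = 8 * m + 6) {k u : ℕ} (hk : k ≤ m)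
    (hF : (forestOf m σ).Inv n k) (hu : σ.reg 10 = u) (hun : u ∈ Finset.Icc 1 n) :
    ∃ t σ', Exec S W perchProg σ t σ' ∧ Moved n m k σ σ' ∧ (forestOf m σ').par u = 0 ∧
      (∀ a, (forestOf m σ).par a = 0 → (forestOf m σ').par a = 0 ∨ (forestOf m σ').par a = u) ∧
      t + 300 * (forestOf m σ').pot n ≤ 300 * (forestOf m σ).pot n + 2130 * (Nat.log 2 n + 1) := by
  have hW := hL.word
  have hui := Finset.mem_Icc.1 hun
  obtain ⟨t₁, σ₁, he₁, hm₁, hv₁, ha₁, ht₁⟩ := exec_perchLoop hL h6 hk hF hu hun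
  have h6₁ : σ₁.reg 6 = 8 * m + 6 := (hm₁.frame.reg 6 (by omega)).trans h6
  have hu₁ : σ₁.reg 10 = u := (hm₁.frame.reg 10 (by omega)).trans hu
  have e₁ : (parE (parE (.reg 10))).eval S W σ₁ =
      some ((forestOf m σ₁).par ((forestOf m σ₁).par u)) :=
    eval_parE hL h6₁ hm₁.inv (eval_parE hL h6₁ hm₁.inv (eval_reg hu₁ (by omega)) hui.2)
      (hm₁.inv.par_le u)
  obtain ⟨t₂, σ₂, he₂, hm₂, hp₂, ht₂⟩ := exec_promoteIf hL h6₁ hk hm₁.inv hu₁ hun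
    (by decide) e₁ (fun h h' => h (by rw [h', hm₁.inv.par_zero]))
  have h6₂ : σ₂.reg 6 = 8 * m + 6 := (hm₂.frame.reg 6 (by omega)).trans h6₁
  have hu₂ : σ₂.reg 10 = u := (hm₂.frame.reg 10 (by omega)).trans hu₁
  have e₂ : (parE (.reg 10)).eval S W σ₂ = some ((forestOf m σ₂).par u) :=
    eval_parE hL h6₂ hm₂.inv (eval_reg hu₂ (by omega)) hui.2
  obtain ⟨t₃, σ₃, he₃, hm₃, hp₃, ht₃⟩ := exec_promoteIf hL h6₂ hk hm₂.inv hu₂ hun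
    (by decide) e₂ (fun h => h)
  have hv₂ : (forestOf m σ₂).par ((forestOf m σ₂).par u) = 0 := by
    rw [hp₂]
    split_ifs with h
    · exact h
    · have h1 : (forestOf m σ₁).par u ≠ 0 := fun h' => h (by rw [h', hm₁.inv.par_zero])
      rw [Forest.promote_par_self, Forest.promote_par_of_ne (hm₁.inv.par_par_ne h1)
        (hm₁.inv.par_ne h), hv₁]
  have ha₂ : ∀ a, (forestOf m σ).par a = 0 → (forestOf m σ₂).par a = 0 := by
    intro a h0
    have h0' := ha₁ a h0
    rw [hp₂]
    split_ifs with h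
    · exact h0'
    · rw [Forest.promote_par_of_ne, h0']
      · rintro rfl
        exact h (by rw [h0', hm₁.inv.par_zero])
      · rintro rfl
        exact h h0'
  refine ⟨_, σ₃, .seq _ _ _ _ _ _ _ he₁ (.seq _ _ _ _ _ _ _ he₂ he₃),
    (hm₁.trans hm₂).trans hm₃, ?_, ?_, ?_⟩
  · rw [hp₃]
    split_ifs with h
    · exact h
    · rw [Forest.promote_par_self, hv₂]
  · intro a h0
    have h0' := ha₂ a h0
    rw [hp₃]
    split_ifs with h
    · exact .inl h0'
    · by_cases hay : a = (forestOf m σ₂).par u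
      · right
        rw [hay]
        exact Forest.promote_par_root hm₂.inv h hv₂
      · left
        rw [Forest.promote_par_of_ne _ hay, h0']
        rintro rfl
        exact h h0'
  · push_cast
    linarith

end RAM

/-! ### Connectivity and touching in windows of edges, and the ordinates that encode them -/

namespace RelationalEventGraph

variable {n m : ℕ} (G : RelationalEventGraph n m)

/-- The first endpoint of the edge `l`, as a number in `{1, …, n}`. -/
def fst (l : ℕ) : ℕ := if h : l < m then (G.edge ⟨l, h⟩).1 + 1 else 0

/-- The second endpoint of the edge `l`, as a number in `{1, …, n}`. -/
def snd (l : ℕ) : ℕ := if h : l < m then (G.edge ⟨l, h⟩).2 + 1 else 0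

theorem fst_mem {l : ℕ} (h : l < m) : G.fst l ∈ Finset.Icc 1 n := by
  rw [fst, dif_pos h, Finset.mem_Icc]
  have := (G.edge ⟨l, h⟩).1.isLt
  omega

theorem snd_mem {l : ℕ} (h : l < m) : G.snd l ∈ Finset.Icc 1 n := by
  rw [snd, dif_pos h, Finset.mem_Icc]
  have := (G.edge ⟨l, h⟩).2.isLt
  omega

/-- Connectivity by the edges `l` with `i ≤ l < k`. -/
def Joined (i k : ℕ) : ℕ → ℕ → Prop :=
  Relation.EqvGen fun a b => ∃ l, i ≤ l ∧ l < k ∧ a = G.fst l ∧ b = G.snd l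

/-- No edge `l` with `i ≤ l < k`, other than self-loops, is incident to `a`. -/
def Untouched (i k a : ℕ) : Prop :=
  ∀ l, i ≤ l → l < k → G.fst l ≠ G.snd l → a ≠ G.fst l ∧ a ≠ G.snd l

/-- `y` tells since when the endpoints of the edge `l` have been connected. -/
structure LoopBound (l y : ℕ) : Prop where
  pos : 1 ≤ y
  le : y ≤ l + 2
  iff : ∀ i ≤ l, (i + 2 ≤ y ↔ G.Joined i l (G.fst l) (G.snd l))

/-- `y` tells when the endpoint `a` of the edge `l` has been touched before. -/
structure TouchBound (l a y : ℕ) : Prop where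
  pos : 1 ≤ y
  le : y ≤ l + 2
  iff : ∀ i ≤ l, (y ≤ i + 1 ↔ G.fst l ≠ G.snd l ∧ G.Untouched i l a)

theorem joined_succ (i k a b : ℕ) : G.Joined i (k + 1) a b ↔
    Relation.EqvGen (fun a b => G.Joined i k a b ∨ (i ≤ k ∧ a = G.fst k ∧ b = G.snd k)) a b := by
  constructor
  · refine Forest.eqvGen_le ?_
    rintro a b ⟨l, hi, hl, h₁, h₂⟩
    refine .rel _ _ ?_
    rcases Nat.lt_succ_iff_lt_or_eq.1 hl with hl | rfl
    · exact .inl (.rel _ _ ⟨l, hi, hl, h₁, h₂⟩)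
    · exact .inr ⟨hi, h₁, h₂⟩
  · refine Forest.eqvGen_le ?_
    rintro a b (h | ⟨hi, h₁, h₂⟩)
    · refine Forest.eqvGen_le ?_ h
      rintro a b ⟨l, hi, hl, h₁, h₂⟩
      exact .rel _ _ ⟨l, hi, by omega, h₁, h₂⟩
    · exact .rel _ _ ⟨k, hi, by omega, h₁, h₂⟩

theorem joined_succ_of_eq {k : ℕ} (h : G.fst k = G.snd k) (i a b : ℕ) :
    G.Joined i (k + 1) a b ↔ G.Joined i k a b := by
  rw [joined_succ]
  constructor
  · refine Forest.eqvGen_le ?_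
    rintro a b (h' | ⟨-, rfl, rfl⟩)
    · exact h'
    · rw [h]
      exact .refl _
  · exact fun h => .rel _ _ (.inl h)

theorem untouched_succ (i k a : ℕ) : G.Untouched i (k + 1) a ↔
    G.Untouched i k a ∧ (i ≤ k → G.fst k ≠ G.snd k → a ≠ G.fst k ∧ a ≠ G.snd k) := by
  constructor
  · exact fun h => ⟨fun l hi hl => h l hi (by omega), fun hi => h k hi (by omega)⟩
  · rintro ⟨h₁, h₂⟩ l hi hl
    rcases Nat.lt_succ_iff_lt_or_eq.1 hl with hl | rfl
    · exact h₁ l hi hl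
    · exact h₂ hi

end RelationalEventGraph

namespace RAM

variable {S W n m : ℕ} {σ σ₁ σ₂ σ₃ : State}

/-! ## Processing an edge -/

/-- Link the vertex in register `8` to the vertex in register `9`. -/
def attachProg : Prog :=
  .seq (.set 18 (.bin .add (field 1 (.reg 8)) (.lit 1))) <|
  .seq (.set 19 (.bin .add (field 3 (.reg 8)) (.lit 1))) <|
  .seq (.set 20 (.bin .add (field 3 (.reg 9)) (.lit 1))) <|
  .seq (.ite (parE (.reg 8)) .skip (.store (fieldAddr 2 (.reg 9))
    (.bin .add (.bin .add (field 2 (.reg 9)) (field 2 (.reg 8))) (.lit 1)))) <|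
  .seq (.store (fieldAddr 0 (.reg 8)) (.reg 9)) <|
  .seq (.store (fieldAddr 1 (.reg 8)) (.bin .add (.reg 7) (.lit 1))) <|
  .seq (.store (fieldAddr 3 (.reg 8)) (.bin .add (.reg 7) (.lit 1))) <|
  .store (fieldAddr 3 (.reg 9)) (.bin .add (.reg 7) (.lit 1))

/-- The old weight and the old last touches are the ordinates of the new points, so they are saved
in registers before being overwritten. -/
theorem runs_attach (hL : Limits n m S W) (h6 : σ.reg 6 = 8 * m + 6) {k u v : ℕ} (hk : k < m)
    (hF : (forestOf m σ).Inv n k) (h7 : σ.reg 7 = k) (h8 : σ.reg 8 = u) (h9 : σ.reg 9 = v)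
    (hu : u ∈ Finset.Icc 1 n) (hv : v ∈ Finset.Icc 1 n) (hlu : fld m σ 3 u ≤ k)
    (hlv : fld m σ 3 v ≤ k) :
    ∃ σ', Runs S W attachProg σ 200 σ' ∧ (∀ r ≤ 9, σ'.reg r = σ.reg r) ∧
      (∀ a < 8 * m + 6, σ'.mem a = σ.mem a) ∧ forestOf m σ' = (forestOf m σ).link u v k ∧
      (∀ a, fld m σ' 3 a = if a = u ∨ a = v then k + 1 else fld m σ 3 a) ∧
      σ'.reg 18 = (forestOf m σ).wt u + 1 ∧ σ'.reg 19 = fld m σ 3 u + 1 ∧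
      σ'.reg 20 = fld m σ 3 v + 1 := by
  have hW := hL.word
  have hui := Finset.mem_Icc.1 hu
  have hvi := Finset.mem_Icc.1 hv
  have hwu := hF.wt_le u
  have heu := hF.ex_lt u hu
  have hev := hF.ex_lt v hv
  have hpu := hF.par_le u
  have r₁ : Runs S W (.set 18 (.bin .add (field 1 (.reg 8)) (.lit 1))) σ 11
      (σ.setReg 18 ((forestOf m σ).wt u + 1)) :=
    Runs.set (eval_add (eval_field hL h6 (eval_reg h8 (by omega)) hui.2 (by omega)
      (hwu.trans (by omega))) (eval_lit (by omega)) (by have : fld m σ 1 u ≤ k := hwu; omega))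
  have r₂ : Runs S W (.set 19 (.bin .add (field 3 (.reg 8)) (.lit 1)))
      (σ.setReg 18 ((forestOf m σ).wt u + 1)) 11
      ((σ.setReg 18 ((forestOf m σ).wt u + 1)).setReg 19 (fld m σ 3 u + 1)) :=
    Runs.set (eval_add (eval_field hL h6 (eval_reg h8 (by omega)) hui.2 (by omega)
      (hlu.trans (by omega))) (eval_lit (by omega)) (by omega))
  have r₃ : Runs S W (.set 20 (.bin .add (field 3 (.reg 9)) (.lit 1)))
      ((σ.setReg 18 ((forestOf m σ).wt u + 1)).setReg 19 (fld m σ 3 u + 1)) 11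
      (((σ.setReg 18 ((forestOf m σ).wt u + 1)).setReg 19 (fld m σ 3 u + 1)).setReg 20
        (fld m σ 3 v + 1)) :=
    Runs.set (eval_add (eval_field hL h6 (eval_reg h9 (by omega)) hvi.2 (by omega)
      (hlv.trans (by omega))) (eval_lit (by omega)) (by omega))
  generalize hτ : (((σ.setReg 18 ((forestOf m σ).wt u + 1)).setReg 19 (fld m σ 3 u + 1)).setReg 20
        (fld m σ 3 v + 1)) = τ at r₃
  have tr : ∀ r ≤ 9, τ.reg r = σ.reg r := by
    intro r hr
    simp only [← hτ, State.setReg_reg]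
    repeat rw [if_neg (by omega)]
  have t18 : τ.reg 18 = (forestOf m σ).wt u + 1 := by simp [← hτ, State.setReg_reg]
  have t19 : τ.reg 19 = fld m σ 3 u + 1 := by simp [← hτ, State.setReg_reg]
  have t20 : τ.reg 20 = fld m σ 3 v + 1 := by simp [← hτ, State.setReg_reg]
  have tm : τ.mem = σ.mem := by simp [← hτ, State.setReg_mem]
  have tf : ∀ c, fld m τ c = fld m σ c := fun c => by simp [← hτ, fld_setReg]
  have tF : forestOf m τ = forestOf m σ := by simp [forestOf, tf]
  clear hτ
  have t6 := (tr 6 (by omega)).trans h6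
  have t7 := (tr 7 (by omega)).trans h7
  have t8 := (tr 8 (by omega)).trans h8
  have t9 := (tr 9 (by omega)).trans h9
  have hFτ : (forestOf m τ).Inv n k := tF ▸ hF
  obtain ⟨ρ, r₄, ρr, ρm, ρf⟩ : ∃ ρ, Runs S W (.ite (parE (.reg 8)) .skip
      (.store (fieldAddr 2 (.reg 9))
        (.bin .add (.bin .add (field 2 (.reg 9)) (field 2 (.reg 8))) (.lit 1)))) τ 50 ρ ∧
      ρ.reg = τ.reg ∧ (∀ a < 8 * m + 6, ρ.mem a = σ.mem a) ∧
      ∀ c < 4, ∀ a, fld m ρ c a = if c = 2 ∧ (forestOf m σ).par u = 0 ∧ a = v then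
        (forestOf m σ).ex v + (forestOf m σ).ex u + 1 else fld m σ c a := by
    have e : (parE (.reg 8)).eval S W τ = some ((forestOf m σ).par u) := by
      rw [← tF]
      exact eval_parE hL t6 hFτ (eval_reg t8 (by omega)) hui.2
    by_cases h0 : (forestOf m σ).par u = 0
    · rw [h0] at e
      refine ⟨_, (Runs.ite_false e (.storeField hL t6 (eval_reg t9 (by omega)) hvi.2 (by omega)
        (eval_add (eval_add (eval_ex hL t6 hFτ (eval_reg t9 (by omega)) hv)
          (eval_ex hL t6 hFτ (eval_reg t8 (by omega)) hu) (by rw [tF]; omega))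
          (eval_lit (by omega)) (by rw [tF]; omega)))).mono (by decide), rfl, ?_, ?_⟩
      · intro a ha
        rw [State.setField_mem _ _ _ _ ha, tm]
      · intro c hc a
        rw [fld_setField _ _ _ _ _ (by omega) hc, tf, tF]
        simp only [h0, true_and]
        split_ifs <;> first | rfl | omega
    · refine ⟨τ, (Runs.ite_true e h0 .skip).mono (by decide), rfl, fun a _ => by rw [tm], ?_⟩
      intro c hc a
      rw [if_neg (by tauto), tf]
  rw [← ρr] at t6 t7 t8 t9 t18 t19 t20
  refine ⟨_, (r₁.seq <| r₂.seq <| r₃.seq <| r₄.seq <|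
    .seq (.storeField (c := 0) hL (by exact t6) (eval_reg (by exact t8) (by omega)) hui.2 (by omega)
      (eval_reg (by exact t9) (by omega))) <|
    .seq (.storeField (c := 1) hL (by exact t6) (eval_reg (by exact t8) (by omega)) hui.2 (by omega)
      (eval_add (eval_reg (by exact t7) (by omega)) (eval_lit (by omega)) (by omega))) <|
    .seq (.storeField (c := 3) hL (by exact t6) (eval_reg (by exact t8) (by omega)) hui.2 (by omega)
      (eval_add (eval_reg (by exact t7) (by omega)) (eval_lit (by omega)) (by omega))) <|
    .storeField (c := 3) hL (by exact t6) (eval_reg (by exact t9) (by omega)) hvi.2 (by omega)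
      (eval_add (eval_reg (by exact t7) (by omega)) (eval_lit (by omega)) (by omega))).mono
    (by decide), fun r hr => ?_, fun a ha => ?_, ?_, fun a => ?_, t18, t19, t20⟩
  · simp only [State.setField_reg]
    rw [ρr, tr r hr]
  · simp only [State.setField_mem _ _ _ _ ha, ρm a ha]
  · ext a
    · simp [forestOf, fld_setField, ρf, Forest.link, Function.update_apply]
    · simp [forestOf, fld_setField, ρf, Forest.link, Function.update_apply]
    · by_cases h0 : fld m σ 0 u = 0 <;>
        simp [forestOf, fld_setField, ρf, Forest.link, h0, Function.update_apply]
  · by_cases h1 : a = u <;> by_cases h2 : a = v <;> simp [fld_setField, ρf, h1, h2]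

/-- Insert the edge between the vertices in the registers `8` and `9`. -/
def insertProg : Prog :=
  .seq (.set 10 (.reg 8)) <| .seq perchProg <| .seq (.set 10 (.reg 9)) <| .seq perchProg attachProg

theorem exec_insert (hL : Limits n m S W) (h6 : σ.reg 6 = 8 * m + 6) {k u v : ℕ} (hk : k < m)
    (hF : (forestOf m σ).Inv n k) (h7 : σ.reg 7 = k) (h8 : σ.reg 8 = u) (h9 : σ.reg 9 = v)
    (hu : u ∈ Finset.Icc 1 n) (hv : v ∈ Finset.Icc 1 n) (huv : u ≠ v) (hlu : fld m σ 3 u ≤ k)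
    (hlv : fld m σ 3 v ≤ k) :
    ∃ t σ', Exec S W insertProg σ t σ' ∧ (∀ r ≤ 9, σ'.reg r = σ.reg r) ∧
      (∀ a < 8 * m + 6, σ'.mem a = σ.mem a) ∧ (forestOf m σ').Inv n (k + 1) ∧
      (∀ i a b, (forestOf m σ').Conn i a b ↔ Relation.EqvGen
        (fun a b => (forestOf m σ).Conn i a b ∨ (i ≤ k ∧ a = u ∧ b = v)) a b) ∧
      (∀ a, fld m σ' 3 a = if a = u ∨ a = v then k + 1 else fld m σ 3 a) ∧
      (∃ w ≤ k, σ'.reg 18 = w + 1 ∧ ∀ i, (forestOf m σ).Conn i u v ↔ i < w) ∧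
      σ'.reg 19 = fld m σ 3 u + 1 ∧ σ'.reg 20 = fld m σ 3 v + 1 ∧
      t + 300 * (forestOf m σ').pot n ≤ 300 * (forestOf m σ).pot n + 4800 * (Nat.log 2 n + 1) := by
  have hW := hL.word
  have hui := Finset.mem_Icc.1 hu
  have hvi := Finset.mem_Icc.1 hv
  have s₁ : Exec S W (.set 10 (.reg 8)) σ 2 (σ.setReg 10 u) :=
    .set σ 10 (.reg 8) u (eval_reg h8 (by omega))
  obtain ⟨t₁, σ₁, he₁, hm₁, hp₁, -, ht₁⟩ := exec_perch (σ := σ.setReg 10 u) hL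
    (by simpa [State.setReg_reg] using h6) hk.le hF (by simp [State.setReg_reg]) hu
  have reg₁ : ∀ r ≤ 9, σ₁.reg r = σ.reg r := fun r hr => by
    rw [hm₁.frame.reg r (by omega), State.setReg_reg, if_neg (by omega)]
  have s₂ : Exec S W (.set 10 (.reg 9)) σ₁ 2 (σ₁.setReg 10 v) :=
    .set σ₁ 10 (.reg 9) v (eval_reg ((reg₁ 9 le_rfl).trans h9) (by omega))
  obtain ⟨t₂, σ₂, he₂, hm₂, hp₂, ha₂, ht₂⟩ := exec_perch (σ := σ₁.setReg 10 v) hL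
    (by simpa [State.setReg_reg] using (reg₁ 6 (by omega)).trans h6) hk.le hm₁.inv
    (by simp [State.setReg_reg]) hv
  have reg₂ : ∀ r ≤ 9, σ₂.reg r = σ.reg r := fun r hr => by
    rw [hm₂.frame.reg r (by omega), State.setReg_reg, if_neg (by omega), reg₁ r hr]
  have mem₂ : ∀ a < 8 * m + 6, σ₂.mem a = σ.mem a := fun a ha => by
    rw [hm₂.frame.mem a ha, State.setReg_mem, hm₁.frame.mem a ha, State.setReg_mem]
  have last₂ : ∀ a, fld m σ₂ 3 a = fld m σ 3 a := fun a => by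
    rw [hm₂.frame.last a, fld_setReg, hm₁.frame.last a, fld_setReg]
  have conn₂ : ∀ i, (forestOf m σ₂).Conn i = (forestOf m σ).Conn i := fun i =>
    (hm₂.conn i).trans (hm₁.conn i)
  -- The first perching makes `u` a root; the second one leaves it a root or turns it into a child
  -- of `v`, as `link` requires.
  have hpu := ha₂ u hp₁
  obtain ⟨σ₃, ⟨t₃, ht₃, he₃⟩, reg₃, mem₃, hf₃, last₃, r18, r19, r20⟩ := runs_attach (σ := σ₂) hL
    ((reg₂ 6 (by omega)).trans h6) hk hm₂.inv ((reg₂ 7 (by omega)).trans h7)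
    ((reg₂ 8 (by omega)).trans h8) ((reg₂ 9 (by omega)).trans h9) hu hv
    (by rw [last₂]; exact hlu) (by rw [last₂]; exact hlv)
  refine ⟨_, σ₃, .seq _ _ _ _ _ _ _ s₁ (.seq _ _ _ _ _ _ _ he₁ (.seq _ _ _ _ _ _ _ s₂
    (.seq _ _ _ _ _ _ _ he₂ he₃))), fun r hr => (reg₃ r hr).trans (reg₂ r hr),
    fun a ha => (mem₃ a ha).trans (mem₂ a ha), ?_, ?_, fun a => ?_,
    ⟨_, hm₂.inv.wt_le u, r18, fun i => ?_⟩, by rw [r19, last₂], by rw [r20, last₂], ?_⟩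
  · rw [hf₃]
    exact Forest.link_inv hm₂.inv hu hv huv hp₂ hpu
  · intro i a b
    rw [hf₃, Forest.link_conn hm₂.inv hpu, conn₂]
  · rw [last₃, last₂]
  · rw [← conn₂]
    exact hm₂.inv.conn_iff (by omega) huv hp₂ hpu
  · have h1 := Forest.pot_link hm₂.inv hu hv huv hp₂ hpu
    rw [← hf₃] at h1
    have h2 : (t₃ : ℝ) ≤ 200 := by exact_mod_cast ht₃
    have h3 : forestOf m (σ.setReg 10 u) = forestOf m σ := rfl
    have h4 : forestOf m (σ₁.setReg 10 v) = forestOf m σ₁ := rfl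
    rw [h3] at ht₁
    rw [h4] at ht₂
    have h5 : (0 : ℝ) ≤ Nat.log 2 n := Nat.cast_nonneg _
    push_cast
    linarith

end RAM

namespace RAM

variable {S W n m : ℕ} {σ : State}

/-! ## The preprocessing -/

/-- Linear expressions in the registers `1` and `7`. -/
def cellE (a b : ℕ) : Expr :=
  .bin .add (.bin .add (.bin .mul (.lit a) (.reg 1)) (.bin .mul (.lit 2) (.reg 7))) (.lit b)

theorem eval_cellE (hL : Limits n m S W) {k a b : ℕ} (h1 : σ.reg 1 = m) (h7 : σ.reg 7 = k)
    (hk : k ≤ m) (ha : a ≤ 10) (hb : b ≤ 10) :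
    (cellE a b).eval S W σ = some (a * m + 2 * k + b) := by
  have hW := hL.word
  have : a * m ≤ 10 * m := Nat.mul_le_mul_right m ha
  exact eval_add (eval_add (eval_mul (eval_lit (by omega)) (eval_reg h1 (by omega)) (by omega))
    (eval_mul (eval_lit (by omega)) (eval_reg h7 (by omega)) (by omega)) (by omega))
    (eval_lit (by omega)) (by omega)

/-- Process the edge between the vertices in the registers `8` and `9`; the ordinates of the new
points are returned in the registers `18`, `19` and `20`. -/
def edgeProg : Prog :=
  .ite (.bin .eq (.reg 8) (.reg 9))
    (.seq (.set 18 (.bin .add (.reg 7) (.lit 2))) <|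
    .seq (.set 19 (.bin .add (.reg 7) (.lit 2))) <|
    .set 20 (.bin .add (.reg 7) (.lit 2)))
    insertProg

/-- The data structure after `k` edges. -/
structure Stage (G : RelationalEventGraph n m) (k : ℕ) (σ : State) : Prop where
  inv : (forestOf m σ).Inv n k
  conn : ∀ i a b, (forestOf m σ).Conn i a b ↔ G.Joined i k a b
  last : ∀ a i, fld m σ 3 a ≤ i ↔ G.Untouched i k a

theorem Stage.last_le {G : RelationalEventGraph n m} {k : ℕ} (h : Stage G k σ) (a : ℕ) :
    fld m σ 3 a ≤ k :=
  (h.last a k).2 fun l h₁ h₂ => by omega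

theorem exec_edge (hL : Limits n m S W) (G : RelationalEventGraph n m) {k : ℕ} (hk : k < m)
    (h6 : σ.reg 6 = 8 * m + 6) (h7 : σ.reg 7 = k) (h8 : σ.reg 8 = G.fst k)
    (h9 : σ.reg 9 = G.snd k) (hG : Stage G k σ) :
    ∃ t σ', Exec S W edgeProg σ t σ' ∧ (∀ r ≤ 9, σ'.reg r = σ.reg r) ∧
      (∀ a < 8 * m + 6, σ'.mem a = σ.mem a) ∧ Stage G (k + 1) σ' ∧
      G.LoopBound k (σ'.reg 18) ∧ G.TouchBound k (G.fst k) (σ'.reg 19) ∧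
      G.TouchBound k (G.snd k) (σ'.reg 20) ∧
      t + 300 * (forestOf m σ').pot n ≤ 300 * (forestOf m σ).pot n + 4900 * (Nat.log 2 n + 1) := by
  have hW := hL.word
  have hu := G.fst_mem hk
  have hv := G.snd_mem hk
  have hui := Finset.mem_Icc.1 hu
  have hvi := Finset.mem_Icc.1 hv
  have h0 : (0 : ℝ) ≤ Nat.log 2 n := Nat.cast_nonneg _
  have he : (Expr.bin .eq (.reg 8) (.reg 9)).eval S W σ =
      some (if G.fst k = G.snd k then 1 else 0) :=
    eval_eq (eval_reg h8 (by omega)) (eval_reg h9 (by omega)) (by omega)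
  by_cases huv : G.fst k = G.snd k
  · rw [if_pos huv] at he
    obtain ⟨t, ht, hr⟩ := Runs.ite_true (q := insertProg) he one_ne_zero <|
      .seq (.set (x := 18) (eval_add (a := k) (b := 2) (eval_reg h7 (by omega))
        (eval_lit (by omega)) (by omega))) <|
      .seq (.set (x := 19) (eval_add (a := k) (b := 2) (eval_reg (x := 7) (by exact h7) (by omega))
        (eval_lit (by omega)) (by omega))) <|
      .set (x := 20) (eval_add (a := k) (b := 2) (eval_reg (x := 7) (by exact h7) (by omega))
        (eval_lit (by omega)) (by omega))
    have hinv : (forestOf m σ).Inv n (k + 1) :=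
      { hG.inv with wt_le := fun v => (hG.inv.wt_le v).trans (by omega) }
    -- A self-loop is never a first touch and always loopy. The ordinate `k + 2`, the largest one
    -- allowed, expresses both: for `i ≤ k` it is at least `i + 2` and never at most `i + 1`.
    have htouch : ∀ a, G.TouchBound k a (k + 2) := fun a =>
      ⟨by omega, le_rfl, fun i hi => ⟨fun h => by omega, fun h => absurd huv h.1⟩⟩
    refine ⟨t, _, hr, fun r hr => ?_, fun a _ => rfl, ⟨hinv, fun i a b => ?_, fun a i => ?_⟩,
      ?_, ?_, ?_, ?_⟩
    · simp only [State.setReg_reg]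
      repeat rw [if_neg (by omega)]
    · rw [G.joined_succ_of_eq huv]
      exact hG.conn i a b
    · rw [G.untouched_succ]
      exact (hG.last a i).trans ⟨fun h => ⟨h, fun _ h => absurd huv h⟩, fun h => h.1⟩
    · simp only [State.setReg_reg]
      exact ⟨by simp, by simp, fun i hi => ⟨fun _ => by rw [huv]; exact .refl _,
        fun _ => by simpa using hi⟩⟩
    · exact htouch _
    · exact htouch _
    · have : (t : ℝ) ≤ 4900 := by
        have h : t ≤ 4900 := ht.trans (by decide)
        exact_mod_cast h
      have h2 : ((forestOf m (((σ.setReg 18 (k + 2)).setReg 19 (k + 2)).setReg 20 (k + 2))).pot n)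
        = (forestOf m σ).pot n := rfl
      rw [h2]
      linarith
  · rw [if_neg huv] at he
    obtain ⟨t, σ', hr, reg', mem', inv', conn', last', ⟨w, hw, r18, hcw⟩, r19, r20, ht⟩ :=
      exec_insert hL h6 hk hG.inv h7 h8 h9 hu hv huv (hG.last_le _) (hG.last_le _)
    have hconn : ∀ i, (forestOf m σ).Conn i = G.Joined i k := fun i => by
      ext a b
      exact hG.conn i a b
    have htouch : ∀ a, G.TouchBound k a (fld m σ 3 a + 1) := fun a => by
      have h1 := hG.last_le a
      refine ⟨by omega, by omega, fun i hi => ?_⟩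
      rw [← hG.last a i]
      exact ⟨fun h => ⟨huv, by omega⟩, fun h => by omega⟩
    refine ⟨_, σ', .ite_false _ _ _ _ _ _ he hr, reg', mem', ⟨inv', ?_, ?_⟩, ?_, ?_, ?_, ?_⟩
    · intro i a b
      rw [conn', G.joined_succ, hconn]
    · intro a i
      rw [last', G.untouched_succ, ← hG.last a i]
      have h1 := hG.last_le a
      split_ifs with h
      · constructor
        · intro h2
          exact ⟨by omega, fun h3 => by omega⟩
        · rintro ⟨-, h2⟩
          by_contra h3
          have := h2 (by omega) huv
          tauto
      · push Not at h
        exact ⟨fun h2 => ⟨h2, fun _ _ => h⟩, fun h2 => h2.1⟩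
    · rw [r18]
      refine ⟨by omega, by omega, fun i hi => ?_⟩
      rw [← hconn, hcw]
      omega
    · rw [r19]
      exact htouch _
    · rw [r20]
      exact htouch _
    · have hc : (Expr.bin .eq (.reg 8) (.reg 9)).cost = 3 := by decide
      rw [hc]
      push_cast
      linarith

/-- Append the point with abscissa `k + 2` and with the ordinate in register `y` to a point set. -/
def pointProg (a b y : ℕ) : Prog :=
  .seq (.store (cellE a b) (.bin .add (.reg 7) (.lit 2))) (.store (cellE a (b + 1)) (.reg y))

/-- Process the edge number `k`, where `k` is in register `7`. -/
def stepProg : Prog :=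
  .seq (.set 8 (.bin .add (.load (cellE 0 0)) (.lit 1))) <|
  .seq (.set 9 (.bin .add (.load (cellE 0 1)) (.lit 1))) <|
  .seq edgeProg <|
  .seq (pointProg 2 2 18) <| .seq (pointProg 4 4 19) <| .seq (pointProg 6 6 20) <|
  .set 7 (.bin .add (.reg 7) (.lit 1))

/-- The state after `k` edges. -/
structure MainInv (G : RelationalEventGraph n m) (k : ℕ) (σ : State) : Prop where
  le : k ≤ m
  reg1 : σ.reg 1 = m
  reg6 : σ.reg 6 = 8 * m + 6
  reg7 : σ.reg 7 = k
  edge : ∀ l < m, σ.mem (2 * l) + 1 = G.fst l ∧ σ.mem (2 * l + 1) + 1 = G.snd l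
  base₀ : σ.mem (2 * m) = 1 ∧ σ.mem (2 * m + 1) = 1
  base₁ : σ.mem (4 * m + 2) = 1 ∧ σ.mem (4 * m + 3) = 1
  base₂ : σ.mem (6 * m + 4) = 1 ∧ σ.mem (6 * m + 5) = 1
  point₀ : ∀ l < k, σ.mem (2 * m + 2 * l + 2) = l + 2 ∧
    G.LoopBound l (σ.mem (2 * m + 2 * l + 3))
  point₁ : ∀ l < k, σ.mem (4 * m + 2 * l + 4) = l + 2 ∧
    G.TouchBound l (G.fst l) (σ.mem (4 * m + 2 * l + 5))
  point₂ : ∀ l < k, σ.mem (6 * m + 2 * l + 6) = l + 2 ∧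
    G.TouchBound l (G.snd l) (σ.mem (6 * m + 2 * l + 7))
  stage : Stage G k σ

theorem runs_point (hL : Limits n m S W) {k a b y v : ℕ} (h1 : σ.reg 1 = m) (h7 : σ.reg 7 = k)
    (hk : k < m) (ha : a ≤ 6) (hb : b ≤ 6) (hy : σ.reg y = v) (hv : v ≤ k + 2) :
    Runs S W (pointProg a b y) σ 30
      ((σ.setMem (a * m + 2 * k + b) (k + 2)).setMem (a * m + 2 * k + (b + 1)) v) := by
  have hW := hL.word
  have hS := hL.space
  have : a * m ≤ 6 * m := Nat.mul_le_mul_right m ha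
  refine (Runs.seq (.store (eval_cellE hL h1 h7 hk.le (by omega) (by omega)) (by omega)
    (eval_add (eval_reg h7 (by omega)) (eval_lit (by omega)) (by omega)))
    (.store (eval_cellE hL (by exact h1) (by exact h7) hk.le (by omega) (by omega)) (by omega)
    (eval_reg (by exact hy) (by omega)))).mono ?_
  simp only [cellE, Expr.cost]
  omega

theorem fld_setMem_low (m : ℕ) (σ : State) {a : ℕ} (ha : a < 8 * m + 6) (v : ℕ) :
    fld m (σ.setMem a v) = fld m σ := by
  funext c x
  simp only [fld]
  rw [State.setMem_mem, if_neg (by omega)]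

theorem Stage.congr {G : RelationalEventGraph n m} {k : ℕ} {σ σ' : State} (h : Stage G k σ)
    (hf : fld m σ' = fld m σ) : Stage G k σ' := by
  have : forestOf m σ' = forestOf m σ := by simp [forestOf, hf]
  exact ⟨this ▸ h.inv, this ▸ h.conn, hf ▸ h.last⟩

theorem exec_step (hL : Limits n m S W) (G : RelationalEventGraph n m) {k : ℕ} (hk : k < m)
    (hI : MainInv G k σ) :
    ∃ t σ', Exec S W stepProg σ t σ' ∧ MainInv G (k + 1) σ' ∧
      t + 300 * (forestOf m σ').pot n ≤ 300 * (forestOf m σ).pot n + 5100 * (Nat.log 2 n + 1) := by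
  have hW := hL.word
  have hS := hL.space
  have hui := Finset.mem_Icc.1 (G.fst_mem hk)
  have hvi := Finset.mem_Icc.1 (G.snd_mem hk)
  obtain ⟨hin₁, hin₂⟩ := hI.edge k hk
  have m₁ : σ.mem (0 * m + 2 * k + 0) + 1 = G.fst k := by simpa using hin₁
  have m₂ : σ.mem (0 * m + 2 * k + 1) + 1 = G.snd k := by simpa using hin₂
  have r₁ : Runs S W (.set 8 (.bin .add (.load (cellE 0 0)) (.lit 1))) σ 13
      (σ.setReg 8 (G.fst k)) := by
    rw [← m₁]
    exact .set (eval_add (eval_load (eval_cellE hL hI.reg1 hI.reg7 hI.le (by omega) (by omega))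
      (by omega) rfl (by omega)) (eval_lit (by omega)) (by omega))
  have r₂ : Runs S W (.set 9 (.bin .add (.load (cellE 0 1)) (.lit 1))) (σ.setReg 8 (G.fst k)) 13
      ((σ.setReg 8 (G.fst k)).setReg 9 (G.snd k)) := by
    rw [← m₂]
    exact .set (eval_add (eval_load (eval_cellE hL hI.reg1 hI.reg7 hI.le (by omega) (by omega))
      (by omega) rfl (by omega)) (eval_lit (by omega))
      (by omega))
  generalize hτ : (σ.setReg 8 (G.fst k)).setReg 9 (G.snd k) = τ at r₂
  have τ8 : τ.reg 8 = G.fst k := by simp [← hτ, State.setReg_reg]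
  have τ9 : τ.reg 9 = G.snd k := by simp [← hτ, State.setReg_reg]
  have τ7 : τ.reg 7 = k := by simp [← hτ, State.setReg_reg, hI.reg7]
  have τ6 : τ.reg 6 = 8 * m + 6 := by simp [← hτ, State.setReg_reg, hI.reg6]
  have τ1 : τ.reg 1 = m := by simp [← hτ, State.setReg_reg, hI.reg1]
  have τm : τ.mem = σ.mem := by simp [← hτ, State.setReg_mem]
  have τf : fld m τ = fld m σ := by simp [← hτ, fld_setReg]
  have τF : forestOf m τ = forestOf m σ := by simp [forestOf, τf]
  clear hτ
  obtain ⟨t₂, ρ, e₂, ρr, ρm, ρs, hloop, htouch₁, htouch₂, ht₂⟩ :=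
    exec_edge hL G hk τ6 τ7 τ8 τ9 (hI.stage.congr τf)
  rw [τF] at ht₂
  have ρ1 := (ρr 1 (by omega)).trans τ1
  have ρ6 := (ρr 6 (by omega)).trans τ6
  have ρ7 := (ρr 7 (by omega)).trans τ7
  obtain ⟨t₁, ht₁, e₁⟩ := r₁
  obtain ⟨t₁', ht₁', e₁'⟩ := r₂
  obtain ⟨t₃, ht₃, e₃⟩ := ((runs_point hL ρ1 ρ7 hk (by omega : 2 ≤ 6) (by omega : 2 ≤ 6)
    (rfl : ρ.reg 18 = _) hloop.le).seq <|
    (runs_point hL (by exact ρ1) (by exact ρ7) hk (by omega : 4 ≤ 6) (by omega : 4 ≤ 6)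
      (y := 19) rfl (by exact htouch₁.le)).seq <|
    (runs_point hL (by exact ρ1) (by exact ρ7) hk (by omega : 6 ≤ 6) (by omega : 6 ≤ 6)
      (y := 20) rfl (by exact htouch₂.le)).seq <|
    .set (x := 7) (eval_add (a := k) (b := 1) (eval_reg (by exact ρ7) (by omega))
      (eval_lit (by omega)) (by omega)))
  simp only [State.setMem_reg] at e₃
  generalize hω : State.setReg _ 7 (k + 1) = ω at e₃
  have ωr : ∀ r, ω.reg r = if r = 7 then k + 1 else ρ.reg r := fun r => by
    rw [← hω, State.setReg_reg]
    simp only [State.setMem_reg]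
  have ωf : fld m ω = fld m ρ := by
    rw [← hω, fld_setReg]
    repeat rw [fld_setMem_low _ _ (by omega)]
  have ωm : ∀ a, ω.mem a =
      if a = 6 * m + 2 * k + (6 + 1) then ρ.reg 20 else
      if a = 6 * m + 2 * k + 6 then k + 2 else
      if a = 4 * m + 2 * k + (4 + 1) then ρ.reg 19 else
      if a = 4 * m + 2 * k + 4 then k + 2 else
      if a = 2 * m + 2 * k + (2 + 1) then ρ.reg 18 else
      if a = 2 * m + 2 * k + 2 then k + 2 else ρ.mem a := fun a => by
    rw [← hω, State.setReg_mem]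
    simp only [State.setMem_mem]
  clear hω
  -- The gaps between these ranges are exactly the three points just written; the input, the extra
  -- points and all earlier points lie in the ranges.
  have old : ∀ a < 8 * m + 6, (a < 2 * m + 2 * k + 2 ∨
      (2 * m + 2 * k + 4 ≤ a ∧ a < 4 * m + 2 * k + 4) ∨
      (4 * m + 2 * k + 6 ≤ a ∧ a < 6 * m + 2 * k + 6)) → ω.mem a = σ.mem a := by
    intro a ha h
    rw [ωm]
    repeat rw [if_neg (by omega)]
    rw [ρm a ha, τm]
  refine ⟨_, ω, .seq _ _ _ _ _ _ _ e₁ (.seq _ _ _ _ _ _ _ e₁' (.seq _ _ _ _ _ _ _ e₂ e₃)),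
    ⟨hk, ?_, ?_, ?_, ?_, ?_, ?_, ?_, ?_, ?_, ?_, ρs.congr ωf⟩, ?_⟩
  · rw [ωr]; exact ρ1
  · rw [ωr]; exact ρ6
  · rw [ωr]; rfl
  · intro l hl
    rw [old _ (by omega) (by omega), old _ (by omega) (by omega)]
    exact hI.edge l hl
  · rw [old _ (by omega) (by omega), old _ (by omega) (by omega)]
    exact hI.base₀
  · rw [old _ (by omega) (by omega), old _ (by omega) (by omega)]
    exact hI.base₁
  · rw [old _ (by omega) (by omega), old _ (by omega) (by omega)]
    exact hI.base₂
  · intro l hl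
    rcases Nat.lt_succ_iff_lt_or_eq.1 hl with hl | rfl
    · rw [old _ (by omega) (by omega), old _ (by omega) (by omega)]
      exact hI.point₀ l hl
    · rw [ωm, ωm]
      repeat rw [if_neg (by omega)]
      rw [if_pos rfl]
      repeat rw [if_neg (by omega)]
      rw [if_pos rfl]
      exact ⟨rfl, hloop⟩
  · intro l hl
    rcases Nat.lt_succ_iff_lt_or_eq.1 hl with hl | rfl
    · rw [old _ (by omega) (by omega), old _ (by omega) (by omega)]
      exact hI.point₁ l hl
    · rw [ωm, ωm]
      repeat rw [if_neg (by omega)]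
      rw [if_pos rfl]
      repeat rw [if_neg (by omega)]
      rw [if_pos rfl]
      exact ⟨rfl, htouch₁⟩
  · intro l hl
    rcases Nat.lt_succ_iff_lt_or_eq.1 hl with hl | rfl
    · rw [old _ (by omega) (by omega), old _ (by omega) (by omega)]
      exact hI.point₂ l hl
    · rw [ωm, ωm]
      repeat rw [if_neg (by omega)]
      rw [if_pos rfl, if_pos rfl]
      exact ⟨rfl, htouch₂⟩
  · have hF : forestOf m ω = forestOf m ρ := by simp [forestOf, ωf]
    have h0 : (0 : ℝ) ≤ Nat.log 2 n := Nat.cast_nonneg _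
    have hc : (Expr.bin .add (.reg 7) (.lit 1)).cost = 3 := by decide
    have h3 : (t₁ + t₁' + t₃ : ℝ) ≤ 200 := by exact_mod_cast (by omega : t₁ + t₁' + t₃ ≤ 200)
    rw [hF]
    push_cast
    linarith

end RAM

/-! ### Initialization, the main loop and the description of the output -/

namespace RAM

variable {S W n m : ℕ} {σ : State}

/-- Linear expressions in register `1`. -/
def linE (a b : ℕ) : Expr := .bin .add (.bin .mul (.lit a) (.reg 1)) (.lit b)

theorem eval_linE (hL : Limits n m S W) {a b : ℕ} (h1 : σ.reg 1 = m) (ha : a ≤ 10) (hb : b ≤ 10) :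
    (linE a b).eval S W σ = some (a * m + b) := by
  have hW := hL.word
  have : a * m ≤ 10 * m := Nat.mul_le_mul_right m ha
  exact eval_add (eval_mul (eval_lit (by omega)) (eval_reg h1 (by omega)) (by omega))
    (eval_lit (by omega)) (by omega)

/-- Put the point `(1, 1)` into a point set. -/
def originProg (a b : ℕ) : Prog :=
  .seq (.store (linE a b) (.lit 1)) (.store (linE a (b + 1)) (.lit 1))

/-- Set up the memory. -/
def initProg : Prog :=
  .seq (.set 6 (linE 8 6)) <|
  .seq (originProg 2 0) <| .seq (originProg 4 2) (originProg 6 4)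

/-- Set up the registers that describe the output. -/
def finishProg : Prog :=
  -- Register `1` is overwritten last, since all these expressions read `m` from it.
  .seq (.set 5 (linE 1 1)) <| .seq (.set 4 (linE 6 4)) <| .seq (.set 3 (linE 1 1)) <|
  .seq (.set 2 (linE 4 2)) <| .seq (.set 0 (linE 2 0)) (.set 1 (linE 1 1))

/-- The preprocessing. -/
def mainProg : Prog :=
  -- For `m = 0` even the extra points would exceed the bound `C * m` on the sizes; skipping
  -- everything leaves three empty sets.
  .ite (.reg 1)
    (.seq initProg <| .seq (.loop (.bin .lt (.reg 7) (.reg 1)) stepProg) finishProg) .skip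

theorem runs_origin (hL : Limits n m S W) {a b : ℕ} (h1 : σ.reg 1 = m) (ha : a ≤ 6) (hb : b ≤ 4) :
    Runs S W (originProg a b) σ 20
      ((σ.setMem (a * m + b) 1).setMem (a * m + (b + 1)) 1) := by
  have hW := hL.word
  have hS := hL.space
  have : a * m ≤ 6 * m := Nat.mul_le_mul_right m ha
  refine (Runs.seq (.store (eval_linE hL h1 (by omega) (by omega)) (by omega)
    (eval_lit (by omega))) (.store (eval_linE hL (by exact h1) (by omega) (by omega)) (by omega)
    (eval_lit (by omega)))).mono ?_
  simp only [linE, Expr.cost]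
  omega

theorem fld_input (G : RelationalEventGraph n m) (c v : ℕ) : fld m (input G) c v = 0 := by
  simp only [fld, input]
  rw [dif_neg (by omega)]

/-- Zero memory already encodes the forest of isolated roots. No pass over the vertices is needed,
which is why the running time has no term linear in `n`. -/
theorem stage_input (G : RelationalEventGraph n m) : Stage G 0 (input G) := by
  refine ⟨⟨?_, ?_, ?_, ?_, ?_, ?_, ?_⟩, fun i a b => ⟨?_, ?_⟩, fun a i => ?_⟩
  · simp [forestOf, fld_input]
  · simp [forestOf, fld_input]
  · simp [forestOf, fld_input]
  · simp [forestOf, fld_input]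
  · intro y hy
    have : y ≠ 0 := by
      have := Finset.mem_Icc.1 hy
      omega
    simp [forestOf, fld_input, this.symm]
  · intro y hy
    have := Finset.mem_Icc.1 hy
    simp only [forestOf, fld_input]
    omega
  · simp [forestOf, fld_input]
  · refine Forest.eqvGen_le ?_
    rintro a b ⟨-, h⟩
    simp [forestOf, fld_input] at h
  · refine Forest.eqvGen_le ?_
    rintro a b ⟨l, -, h, -⟩
    omega
  · rw [fld_input]
    exact iff_of_true (Nat.zero_le i) fun l _ h => by omega

theorem pot_input (G : RelationalEventGraph n m) : (forestOf m (input G)).pot n = 0 := by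
  refine Finset.sum_eq_zero fun v _ => ?_
  simp [Forest.lsize, forestOf, fld_input]

theorem runs_init (hL : Limits n m S W) (G : RelationalEventGraph n m) :
    ∃ σ', Runs S W initProg (input G) 70 σ' ∧ MainInv G 0 σ' ∧ (forestOf m σ').pot n = 0 := by
  have i1 : (input G).reg 1 = m := rfl
  have r := (Runs.set (S := S) (W := W) (x := 6) (eval_linE hL i1 (by omega : 8 ≤ 10)
    (by omega : 6 ≤ 10))).seq <|
    (runs_origin hL (by exact i1) (by omega : 2 ≤ 6) (by omega : 0 ≤ 4)).seq <|
    (runs_origin hL (by exact i1) (by omega : 4 ≤ 6) (by omega : 2 ≤ 4)).seq <|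
    runs_origin hL (by exact i1) (by omega : 6 ≤ 6) (by omega : 4 ≤ 4)
  generalize hω : State.setMem _ (6 * m + (4 + 1)) 1 = ω at r
  have ωr : ∀ x, ω.reg x = if x = 6 then 8 * m + 6 else (input G).reg x := fun x => by
    rw [← hω]
    simp only [State.setMem_reg, State.setReg_reg]
  have ωf : fld m ω = fld m (input G) := by
    rw [← hω]
    repeat rw [fld_setMem_low _ _ (by omega)]
    rw [fld_setReg]
  have ωm : ∀ a, ω.mem a =
      if a = 6 * m + (4 + 1) then 1 else if a = 6 * m + 4 then 1 else
      if a = 4 * m + (2 + 1) then 1 else if a = 4 * m + 2 then 1 else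
      if a = 2 * m + (0 + 1) then 1 else if a = 2 * m + 0 then 1 else (input G).mem a := fun a => by
    rw [← hω]
    simp only [State.setMem_mem, State.setReg_mem]
  clear hω
  have one : ∀ a, a = 6 * m + 5 ∨ a = 6 * m + 4 ∨ a = 4 * m + 3 ∨ a = 4 * m + 2 ∨ a = 2 * m + 1 ∨
      a = 2 * m → ω.mem a = 1 := by
    intro a ha
    rw [ωm]
    split_ifs <;> omega
  refine ⟨ω, r.mono (by decide), ⟨Nat.zero_le _, ?_, ?_, ?_, ?_, ?_, ?_, ?_, ?_, ?_, ?_,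
    (stage_input G).congr ωf⟩, ?_⟩
  · rw [ωr]; rfl
  · rw [ωr]; rfl
  · rw [ωr]; rfl
  · intro l hl
    rw [ωm, ωm]
    repeat rw [if_neg (by omega)]
    simp only [input, RelationalEventGraph.fst, RelationalEventGraph.snd]
    have h1 : 2 * l / 2 = l := by omega
    have h2 : (2 * l + 1) / 2 = l := by omega
    have h3 : ¬ (2 * l + 1) % 2 = 0 := by omega
    have h4 : 2 * l % 2 = 0 := by omega
    simp [h1, h2, hl]
  · exact ⟨one _ (by omega), one _ (by omega)⟩
  · exact ⟨one _ (by omega), one _ (by omega)⟩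
  · exact ⟨one _ (by omega), one _ (by omega)⟩
  · intro l hl; omega
  · intro l hl; omega
  · intro l hl; omega
  · have : forestOf m ω = forestOf m (input G) := by simp [forestOf, ωf]
    rw [this, pot_input]

theorem exec_mainLoop (hL : Limits n m S W) (G : RelationalEventGraph n m)
    (hI : MainInv G 0 σ) (hpot : (forestOf m σ).pot n = 0) :
    ∃ t σ', Exec S W (.loop (.bin .lt (.reg 7) (.reg 1)) stepProg) σ t σ' ∧ MainInv G m σ' ∧
      (t : ℝ) ≤ 5200 * (m * (Nat.log 2 n + 1)) + 4 := by
  have hW := hL.word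
  have hc : (Expr.bin .lt (.reg 7) (.reg 1)).cost = 3 := by decide
  have h0 : (0 : ℝ) ≤ Nat.log 2 n := Nat.cast_nonneg _
  obtain ⟨t, σ', he, hI', hv, ht⟩ := exec_loop (S := S) (W := W)
    (e := .bin .lt (.reg 7) (.reg 1)) (p := stepProg)
    (fun τ => MainInv G (τ.reg 7) τ) (fun τ => if τ.reg 7 < m then 1 else 0)
    -- The forest potential plus a credit for each remaining edge: `5100` for the step and the rest
    -- for the test.
    (fun τ => 300 * (forestOf m τ).pot n + 5200 * ((m - τ.reg 7) * (Nat.log 2 n + 1)))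
    (by
      intro τ hτ
      have h1 := (forestOf m τ).pot_nonneg n
      have h2 : (τ.reg 7 : ℝ) ≤ m := by exact_mod_cast hτ.le
      have h3 : 0 ≤ ((m : ℝ) - τ.reg 7) * (Nat.log 2 n + 1) :=
        mul_nonneg (by linarith) (by linarith)
      linarith)
    (by
      intro τ hτ
      have := hτ.le
      exact eval_lt (eval_reg rfl (by omega)) (eval_reg hτ.reg1 (by omega)) (by omega))
    (by
      intro τ hτ hv
      have hk : τ.reg 7 < m := by
        by_contra h
        exact hv (if_neg h)
      obtain ⟨t, σ', he, hI', ht⟩ := exec_step hL G hk hτ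
      refine ⟨t, σ', he, ?_, ?_⟩
      · rw [hI'.reg7]
        exact hI'
      · rw [hc, hI'.reg7]
        push_cast
        linarith)
    σ (by rw [hI.reg7]; exact hI)
  have hk : σ'.reg 7 = m := by
    have h1 := hI'.le
    by_contra h
    rw [if_pos (by omega)] at hv
    omega
  rw [hk] at hI'
  refine ⟨t, σ', he, hI', ?_⟩
  have h1 := (forestOf m σ').pot_nonneg n
  rw [hk, hI.reg7, hpot, hc] at ht
  push_cast at ht
  linarith

theorem runs_finish (hL : Limits n m S W) (h1 : σ.reg 1 = m) :
    ∃ σ', Runs S W finishProg σ 40 σ' ∧ σ'.mem = σ.mem ∧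
      σ'.reg 0 = 2 * m ∧ σ'.reg 1 = m + 1 ∧ σ'.reg 2 = 4 * m + 2 ∧ σ'.reg 3 = m + 1 ∧
      σ'.reg 4 = 6 * m + 4 ∧ σ'.reg 5 = m + 1 := by
  have r := (Runs.set (S := S) (W := W) (x := 5) (eval_linE hL h1 (by omega : 1 ≤ 10)
    (by omega : 1 ≤ 10))).seq <|
    (Runs.set (x := 4) (eval_linE hL (by exact h1) (by omega : 6 ≤ 10) (by omega : 4 ≤ 10))).seq <|
    (Runs.set (x := 3) (eval_linE hL (by exact h1) (by omega : 1 ≤ 10) (by omega : 1 ≤ 10))).seq <|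
    (Runs.set (x := 2) (eval_linE hL (by exact h1) (by omega : 4 ≤ 10) (by omega : 2 ≤ 10))).seq <|
    (Runs.set (x := 0) (eval_linE hL (by exact h1) (by omega : 2 ≤ 10) (by omega : 0 ≤ 10))).seq <|
    Runs.set (x := 1) (eval_linE hL (by exact h1) (by omega : 1 ≤ 10) (by omega : 1 ≤ 10))
  refine ⟨_, r.mono (by decide), rfl, ?_, ?_, ?_, ?_, ?_, ?_⟩ <;> simp [State.setReg_reg]

theorem exec_main (hL : Limits n m S W) (G : RelationalEventGraph n m) (hm : m ≠ 0) :
    ∃ t σ τ, Exec S W mainProg (input G) t σ ∧ t ≤ 6000 * (m * (Nat.log 2 n + 1) + 1) ∧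
      MainInv G m τ ∧ σ.mem = τ.mem ∧
      σ.reg 0 = 2 * m ∧ σ.reg 1 = m + 1 ∧ σ.reg 2 = 4 * m + 2 ∧ σ.reg 3 = m + 1 ∧
      σ.reg 4 = 6 * m + 4 ∧ σ.reg 5 = m + 1 := by
  have hW := hL.word
  obtain ⟨σ₁, ⟨t₁, ht₁, he₁⟩, hI₁, hp₁⟩ := runs_init hL G
  obtain ⟨t₂, σ₂, he₂, hI₂, ht₂⟩ := exec_mainLoop hL G hI₁ hp₁
  obtain ⟨σ₃, ⟨t₃, ht₃, he₃⟩, hmem, hregs⟩ := runs_finish hL hI₂.reg1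
  refine ⟨_, σ₃, σ₂, .ite_true _ _ _ _ _ m _ (eval_reg rfl (by omega)) hm
    (.seq _ _ _ _ _ _ _ he₁ (.seq _ _ _ _ _ _ _ he₂ he₃)), ?_, hI₂, hmem, hregs⟩
  have hc : (Expr.reg 1).cost = 1 := rfl
  have h2 : t₂ ≤ 5200 * (m * (Nat.log 2 n + 1)) + 4 := by exact_mod_cast ht₂
  rw [hc]
  omega

end RAM

/-! ## Counting components -/

namespace SimpleGraph

variable {V : Type*} {H H' : SimpleGraph V}

/-- Joining two components decreases the number of components by one. -/
theorem card_connectedComponent_of_join [Finite V] (u v : V) (huv : ¬H.Reachable u v)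
    (h : ∀ a b, H'.Reachable a b ↔ H.Reachable a b ∨ (H.Reachable a u ∧ H.Reachable v b) ∨
      (H.Reachable a v ∧ H.Reachable u b)) :
    Nat.card H.ConnectedComponent = Nat.card H'.ConnectedComponent + 1 := by
  classical
  have hle : ∀ a b, H.Reachable a b → H'.Reachable a b := fun a b hab => (h a b).2 (.inl hab)
  let f : H.ConnectedComponent → H'.ConnectedComponent :=
    Quot.map id hle
  have hf : ∀ a, f (H.connectedComponentMk a) = H'.connectedComponentMk a := fun _ => rfl
  -- The components other than that of `v` correspond to the new components; the merged one is
  -- represented by the component of `u`.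
  have hbij : Function.Bijective
      fun c : {c : H.ConnectedComponent // c ≠ H.connectedComponentMk v} => f c := by
    constructor
    · rintro ⟨c, hc⟩ ⟨d, hd⟩ hcd
      induction c using ConnectedComponent.ind with | _ a
      induction d using ConnectedComponent.ind with | _ b
      rw [Ne, ConnectedComponent.eq] at hc hd
      simp only [hf, ConnectedComponent.eq, h] at hcd
      refine Subtype.ext (ConnectedComponent.eq.2 ?_)
      rcases hcd with hcd | hcd | hcd
      · exact hcd
      · exact absurd hcd.2.symm hd
      · exact absurd hcd.1 hc
    · intro c
      induction c using ConnectedComponent.ind with | _ a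
      by_cases ha : H.Reachable a v
      · refine ⟨⟨H.connectedComponentMk u, fun h' => huv (ConnectedComponent.eq.1 h')⟩, ?_⟩
        simp only [hf, ConnectedComponent.eq, h]
        exact .inr (.inl ⟨.refl u, ha.symm⟩)
      · exact ⟨⟨H.connectedComponentMk a, fun h' => ha (ConnectedComponent.eq.1 h')⟩, rfl⟩
  rw [← Nat.card_congr (Equiv.ofBijective _ hbij)]
  have := Fintype.ofFinite H.ConnectedComponent
  have hpos : 0 < Fintype.card H.ConnectedComponent :=
    Fintype.card_pos_iff.2 ⟨H.connectedComponentMk v⟩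
  rw [Nat.card_eq_fintype_card, Nat.card_eq_fintype_card, Fintype.card_subtype_compl,
    Fintype.card_subtype_eq]
  omega

theorem card_connectedComponent_congr [Finite V]
    (h : ∀ a b, H'.Reachable a b ↔ H.Reachable a b) :
    Nat.card H.ConnectedComponent = Nat.card H'.ConnectedComponent :=
  Nat.card_congr (Quot.congrRight fun a b => (h a b).symm)

/-- A walk from `v` to another vertex begins with an edge at `v`. -/
theorem one_lt_ncard_supp_iff [Finite V] (v : V) :
    1 < (H.connectedComponentMk v).supp.ncard ↔ ∃ w, H.Adj v w := by
  rw [Set.one_lt_ncard]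
  constructor
  · rintro ⟨a, ha, b, hb, hab⟩
    have hav : H.Reachable v a := (ConnectedComponent.eq.1 ha).symm
    have hbv : H.Reachable v b := (ConnectedComponent.eq.1 hb).symm
    have key : ∀ x, H.Reachable v x → v ≠ x → ∃ w, H.Adj v w := by
      rintro x ⟨p⟩ hx
      cases p with
      | nil => exact absurd rfl hx
      | cons h _ => exact ⟨_, h⟩
    by_cases h : v = a
    · exact key b hbv (h ▸ hab)
    · exact key a hav h
  · rintro ⟨w, hw⟩
    exact ⟨v, rfl, w, ConnectedComponent.eq.2 hw.reachable.symm, hw.ne⟩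

/-- Isolated vertices correspond bijectively to trivial components. -/
theorem card_nontrivial_add [Finite V] :
    Nat.card {c : H.ConnectedComponent // 1 < c.supp.ncard} + Nat.card {v // ¬∃ w, H.Adj v w} =
      Nat.card H.ConnectedComponent := by
  classical
  have hbij : Function.Bijective fun v : {v // ¬∃ w, H.Adj v w} =>
      (⟨H.connectedComponentMk v, fun h => v.2 ((one_lt_ncard_supp_iff _).1 h)⟩ :
        {c : H.ConnectedComponent // ¬1 < c.supp.ncard}) := by
    constructor
    · rintro ⟨a, ha⟩ ⟨b, hb⟩ hab
      obtain ⟨p⟩ := ConnectedComponent.eq.1 (Subtype.ext_iff.1 hab)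
      refine Subtype.ext ?_
      cases p with
      | nil => rfl
      | cons h _ => exact absurd ⟨_, h⟩ ha
    · rintro ⟨c, hc⟩
      induction c using ConnectedComponent.ind with | _ a
      exact ⟨⟨a, fun h => hc ((one_lt_ncard_supp_iff _).2 h)⟩, rfl⟩
  rw [Nat.card_congr (Equiv.ofBijective _ hbij), ← Nat.card_sum]
  exact Nat.card_congr (Equiv.sumCompl _)

/-- The vertices are fibred over their components. -/
theorem finsum_ncard_supp [Finite V] (P : H.ConnectedComponent → Prop) :
    ∑ᶠ c : {c : H.ConnectedComponent // P c}, (c.1.supp.ncard : ℚ) =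
      Nat.card {v // P (H.connectedComponentMk v)} := by
  classical
  have := Fintype.ofFinite {c : H.ConnectedComponent // P c}
  rw [finsum_eq_sum_of_fintype, ← Nat.cast_sum, Nat.cast_inj]
  have e : (Σ c : {c : H.ConnectedComponent // P c}, c.1.supp) ≃
      {v // P (H.connectedComponentMk v)} :=
    { toFun := fun x => ⟨x.2.1, by
        rw [(ConnectedComponent.mem_supp_iff _ _).1 x.2.2]
        exact x.1.2⟩
      invFun := fun v => ⟨⟨_, v.2⟩, ⟨v.1, rfl⟩⟩
      left_inv := by
        rintro ⟨⟨c, hc⟩, ⟨v, hv⟩⟩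
        rw [ConnectedComponent.mem_supp_iff] at hv
        subst hv
        rfl
      right_inv := fun _ => rfl }
  rw [← Nat.card_congr e, Nat.card_sigma]
  rfl

end SimpleGraph

/-! ### Components and loopy edges of a window -/

namespace RelationalEventGraph

variable {n m : ℕ} (G : RelationalEventGraph n m)

theorem window_adj_iff {i k : ℕ} (a b : Fin n) : (G.window i k).Adj a b ↔ a ≠ b ∧
    ∃ l, i ≤ l ∧ l < k ∧ ((a + 1 = G.fst l ∧ b + 1 = G.snd l) ∨
      (b + 1 = G.fst l ∧ a + 1 = G.snd l)) := by
  have key : ∀ a b : Fin n, (∃ l : Fin m, i ≤ (l : ℕ) ∧ (l : ℕ) < k ∧ G.edge l = (a, b)) ↔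
      ∃ l, i ≤ l ∧ l < k ∧ a + 1 = G.fst l ∧ b + 1 = G.snd l := by
    intro a b
    constructor
    · rintro ⟨l, h₁, h₂, h₃⟩
      refine ⟨l, h₁, h₂, ?_, ?_⟩
      · rw [fst, dif_pos l.2, h₃]
      · rw [snd, dif_pos l.2, h₃]
    · rintro ⟨l, h₁, h₂, h₃, h₄⟩
      by_cases hl : l < m
      · rw [fst, dif_pos hl] at h₃
        rw [snd, dif_pos hl] at h₄
        exact ⟨⟨l, hl⟩, h₁, h₂, Prod.ext (Fin.ext (by simp only; omega)) (Fin.ext (by simp only; omega))⟩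
      · rw [fst, dif_neg hl] at h₃
        omega
  rw [window, SimpleGraph.fromRel_adj, key, key]
  refine and_congr_right fun _ => ⟨?_, ?_⟩
  · rintro (⟨l, h₁, h₂, h⟩ | ⟨l, h₁, h₂, h⟩)
    · exact ⟨l, h₁, h₂, .inl h⟩
    · exact ⟨l, h₁, h₂, .inr h⟩
  · rintro ⟨l, h₁, h₂, h | h⟩
    · exact .inl ⟨l, h₁, h₂, h⟩
    · exact .inr ⟨l, h₁, h₂, h⟩

theorem reachable_iff {i k : ℕ} (hk : k ≤ m) (a b : Fin n) :
    (G.window i k).Reachable a b ↔ G.Joined i k (a + 1) (b + 1) := by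
  constructor
  · rintro ⟨p⟩
    induction p with
    | nil => exact .refl _
    | cons h _ ih =>
      refine .trans _ _ _ ?_ ih
      obtain ⟨-, l, h₁, h₂, h | h⟩ := (G.window_adj_iff _ _).1 h
      · exact .rel _ _ ⟨l, h₁, h₂, h.1, h.2⟩
      · exact .symm _ _ (.rel _ _ ⟨l, h₁, h₂, h.1, h.2⟩)
  -- `Joined` lives on all of `ℕ` and is reflexive outside `{1, …, n}` too, hence the first
  -- alternative.
  · have key : ∀ x y, G.Joined i k x y → x = y ∨
        ∃ a b : Fin n, x = a + 1 ∧ y = b + 1 ∧ (G.window i k).Reachable a b := by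
      intro x y hxy
      induction hxy with
      | rel x y h =>
        obtain ⟨l, h₁, h₂, hx, hy⟩ := h
        have hl : l < m := by omega
        by_cases hne : x = y
        · exact .inl hne
        right
        have hx' := hx
        have hy' := hy
        rw [fst, dif_pos hl] at hx'
        rw [snd, dif_pos hl] at hy'
        refine ⟨_, _, hx', hy', SimpleGraph.Adj.reachable ((G.window_adj_iff _ _).2
          ⟨fun h => hne (by rw [hx', hy', h]), l, h₁, h₂,
            .inl ⟨by rw [← hx', hx], by rw [← hy', hy]⟩⟩)⟩
      | refl => exact .inl rfl
      | symm x y _ ih =>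
        rcases ih with h | ⟨a, b, h₁, h₂, h₃⟩
        · exact .inl h.symm
        · exact .inr ⟨b, a, h₂, h₁, h₃.symm⟩
      | trans x y z _ _ ih₁ ih₂ =>
        rcases ih₁ with rfl | ⟨a, b, h₁, h₂, h₃⟩
        · exact ih₂
        · rcases ih₂ with rfl | ⟨b', c, h₁', h₂', h₃'⟩
          · exact .inr ⟨a, b, h₁, h₂, h₃⟩
          · have : b = b' := Fin.ext (by omega)
            subst this
            exact .inr ⟨a, c, h₁, h₂', h₃.trans h₃'⟩
    intro h
    rcases key _ _ h with h | ⟨a', b', h₁, h₂, h₃⟩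
    · have : a = b := Fin.ext (by omega)
      rw [this]
    · have h₁ : a = a' := Fin.ext (by omega)
      have h₂ : b = b' := Fin.ext (by omega)
      rw [h₁, h₂]
      exact h₃

/-- A connection needs the new edge at most once, in one of its two directions. -/
theorem joined_succ_iff {i k : ℕ} (hi : i ≤ k) (a b : ℕ) : G.Joined i (k + 1) a b ↔
    G.Joined i k a b ∨ (G.Joined i k a (G.fst k) ∧ G.Joined i k (G.snd k) b) ∨
      (G.Joined i k a (G.snd k) ∧ G.Joined i k (G.fst k) b) := by
  have symm : ∀ {x y}, G.Joined i k x y → G.Joined i k y x := fun h => .symm _ _ h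
  have trans : ∀ {x y z}, G.Joined i k x y → G.Joined i k y z → G.Joined i k x z :=
    fun h h' => .trans _ _ _ h h'
  have refl : ∀ x, G.Joined i k x x := fun x => .refl x
  rw [joined_succ]
  constructor
  · intro h
    induction h with
    | rel x y h =>
      rcases h with h | ⟨-, rfl, rfl⟩
      · exact .inl h
      · exact .inr (.inl ⟨refl _, refl _⟩)
    | refl x => exact .inl (refl x)
    | symm x y _ ih =>
      rcases ih with h | h | h
      · exact .inl (symm h)
      · exact .inr (.inr ⟨symm h.2, symm h.1⟩)
      · exact .inr (.inl ⟨symm h.2, symm h.1⟩)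
    | trans x y z _ _ ih₁ ih₂ =>
      rcases ih₁ with h | h | h <;> rcases ih₂ with h' | h' | h'
      · exact .inl (trans h h')
      · exact .inr (.inl ⟨trans h h'.1, h'.2⟩)
      · exact .inr (.inr ⟨trans h h'.1, h'.2⟩)
      · exact .inr (.inl ⟨h.1, trans h.2 h'⟩)
      · exact .inr (.inl ⟨h.1, h'.2⟩)
      · exact .inl (trans h.1 h'.2)
      · exact .inr (.inr ⟨h.1, trans h.2 h'⟩)
      · exact .inl (trans h.1 h'.2)
      · exact .inr (.inr ⟨h.1, h'.2⟩)
  · have inj : ∀ {x y}, G.Joined i k x y → Relation.EqvGen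
        (fun a b => G.Joined i k a b ∨ i ≤ k ∧ a = G.fst k ∧ b = G.snd k) x y :=
      fun h => .rel _ _ (.inl h)
    have new : Relation.EqvGen (fun a b => G.Joined i k a b ∨ i ≤ k ∧ a = G.fst k ∧ b = G.snd k)
        (G.fst k) (G.snd k) := .rel _ _ (.inr ⟨hi, rfl, rfl⟩)
    rintro (h | h | h)
    · exact inj h
    · exact .trans _ _ _ (inj h.1) (.trans _ _ _ new (inj h.2))
    · exact .trans _ _ _ (inj h.1) (.trans _ _ _ (.symm _ _ new) (inj h.2))

open Classical in
/-- The edges `l` with `i ≤ l < k` whose endpoints are connected by the edges since `i` before. -/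
noncomputable def loopySet (i k : ℕ) : Finset ℕ :=
  (Finset.Ico i k).filter fun l => G.Joined i l (G.fst l) (G.snd l)

/-- Induction on the right end: the new edge is loopy and changes no connectivity, or it joins two
components. The terms are arranged so that `k - i` is the only subtraction. -/
theorem card_components {i k : ℕ} (hi : i ≤ k) (hk : k ≤ m) :
    Nat.card (G.window i k).ConnectedComponent + (k - i) = n + (G.loopySet i k).card := by
  classical
  induction k, hi using Nat.le_induction with
  | base =>
    have h1 : Nat.card (G.window i i).ConnectedComponent = n := by
      have : ∀ a b, G.Joined i i a b → a = b := by
        intro a b h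
        induction h with
        | rel a b h => obtain ⟨l, h₁, h₂, -⟩ := h; omega
        | refl => rfl
        | symm a b _ ih => exact ih.symm
        | trans a b c _ _ ih₁ ih₂ => exact ih₁.trans ih₂
      have hbij : Function.Bijective (G.window i i).connectedComponentMk := by
        refine ⟨fun a b hab => ?_, fun c => ?_⟩
        · have := this _ _ ((G.reachable_iff hk a b).1 (SimpleGraph.ConnectedComponent.eq.1 hab))
          exact Fin.ext (by omega)
        · induction c using SimpleGraph.ConnectedComponent.ind with | _ a
          exact ⟨a, rfl⟩
      rw [← Nat.card_congr (Equiv.ofBijective _ hbij), Nat.card_fin]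
    rw [h1]
    simp [loopySet]
  | succ k hi ih =>
    have ih := ih (by omega)
    have hkm : k < m := by omega
    have hu : G.fst k = (G.edge ⟨k, hkm⟩).1 + 1 := by rw [fst, dif_pos hkm]
    have hv : G.snd k = (G.edge ⟨k, hkm⟩).2 + 1 := by rw [snd, dif_pos hkm]
    have hset : G.loopySet i (k + 1) = if G.Joined i k (G.fst k) (G.snd k) then
        insert k (G.loopySet i k) else G.loopySet i k := by
      rw [loopySet, ← Finset.insert_Ico_right_eq_Ico_add_one hi, Finset.filter_insert]
      congr
    have hnot : k ∉ G.loopySet i k := by simp [loopySet]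
    have hr := G.joined_succ_iff hi
    rw [hset]
    split_ifs with h
    · rw [Finset.card_insert_of_notMem hnot, ← SimpleGraph.card_connectedComponent_congr
        (H := G.window i k)]
      · omega
      · intro a b
        rw [G.reachable_iff hk, G.reachable_iff hkm.le, hr]
        refine ⟨?_, .inl⟩
        rintro (h' | h' | h')
        · exact h'
        · exact .trans _ _ _ h'.1 (.trans _ _ _ h h'.2)
        · exact .trans _ _ _ h'.1 (.trans _ _ _ (.symm _ _ h) h'.2)
    · have := SimpleGraph.card_connectedComponent_of_join (H := G.window i k)
        (H' := G.window i (k + 1)) (G.edge ⟨k, hkm⟩).1 (G.edge ⟨k, hkm⟩).2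
        (by rw [G.reachable_iff hkm.le, ← hu, ← hv]; exact h)
        (by
          intro a b
          simp only [G.reachable_iff hk, G.reachable_iff hkm.le, ← hu, ← hv]
          exact hr _ _)
      omega

theorem numComponents_eq {i j : ℕ} (hi : i ≤ j) (hj : j < m) :
    (G.numComponents i j : ℤ) = n + (G.loopySet i (j + 1)).card + i - (j + 1) := by
  have := G.card_components (i := i) (k := j + 1) (by omega) hj
  unfold numComponents slice
  omega

theorem numLoopyEdges_eq {i j : ℕ} (hj : j < m) :
    G.numLoopyEdges i j = (G.loopySet i (j + 1)).card := by
  classical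
  unfold numLoopyEdges
  rw [Nat.card_eq_fintype_card, Fintype.card_subtype]
  refine Finset.card_bij (fun l _ => (l : ℕ)) ?_ (fun a _ b _ h => Fin.ext h) ?_
  · intro l hl
    simp only [Finset.mem_filter, Finset.mem_univ, true_and] at hl
    simp only [loopySet, Finset.mem_filter, Finset.mem_Ico]
    refine ⟨by omega, ?_⟩
    have := (G.reachable_iff l.2.le _ _).1 hl.2.2
    rwa [fst, snd, dif_pos l.2, dif_pos l.2]
  · intro l hl
    simp only [loopySet, Finset.mem_filter, Finset.mem_Ico] at hl
    have hlm : l < m := by omega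
    refine ⟨⟨l, hlm⟩, ?_, rfl⟩
    simp only [Finset.mem_filter, Finset.mem_univ, true_and]
    refine ⟨hl.1.1, by omega, ?_⟩
    rw [G.reachable_iff hlm.le]
    have := hl.2
    rwa [fst, snd, dif_pos hlm, dif_pos hlm] at this

/-! ## Counting the vertices of nontrivial components -/

open Classical in
/-- The vertices that are incident to an edge `l` with `i ≤ l < k`, other than a self-loop. -/
noncomputable def touchedSet (i k : ℕ) : Finset ℕ :=
  (Finset.Icc 1 n).filter fun a => ¬G.Untouched i k a

open Classical in
/-- The edges `l` with `i ≤ l < k`, other than self-loops, that are the first since `i` to touch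
their endpoint `f l`. -/
noncomputable def firstTouchSet (f : ℕ → ℕ) (i k : ℕ) : Finset ℕ :=
  (Finset.Ico i k).filter fun l => G.fst l ≠ G.snd l ∧ G.Untouched i l (f l)

theorem firstTouchSet_succ (f : ℕ → ℕ) {i k : ℕ} (hi : i ≤ k) [Decidable (G.Untouched i k (f k))]
    (h : G.fst k ≠ G.snd k) :
    (G.firstTouchSet f i (k + 1)).card =
      (G.firstTouchSet f i k).card + if G.Untouched i k (f k) then 1 else 0 := by
  rw [firstTouchSet, ← Finset.insert_Ico_right_eq_Ico_add_one hi, Finset.filter_insert]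
  by_cases hu : G.Untouched i k (f k)
  · rw [if_pos ⟨h, hu⟩, Finset.card_insert_of_notMem (by simp), if_pos hu]
    rfl
  · rw [if_neg (by tauto), if_neg hu]
    rfl

theorem firstTouchSet_succ_of_eq (f : ℕ → ℕ) {i k : ℕ} (hi : i ≤ k) (h : G.fst k = G.snd k) :
    G.firstTouchSet f i (k + 1) = G.firstTouchSet f i k := by
  rw [firstTouchSet, ← Finset.insert_Ico_right_eq_Ico_add_one hi, Finset.filter_insert,
    if_neg (by tauto)]
  rfl

/-- The endpoints of an edge that is no self-loop are distinct, so the untouched ones among them are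
counted once each, on their own sides. A self-loop changes nothing. -/
theorem card_touchedSet {i k : ℕ} (hi : i ≤ k) (hk : k ≤ m) :
    (G.touchedSet i k).card =
      (G.firstTouchSet G.fst i k).card + (G.firstTouchSet G.snd i k).card := by
  classical
  induction k, hi using Nat.le_induction with
  | base =>
    have : ∀ a, G.Untouched i i a := fun a l _ _ => by omega
    simp [touchedSet, firstTouchSet, this]
  | succ k hi ih =>
    have ih := ih (by omega)
    have hkm : k < m := by omega
    by_cases h : G.fst k = G.snd k
    · rw [G.firstTouchSet_succ_of_eq _ hi h, G.firstTouchSet_succ_of_eq _ hi h, ← ih]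
      congr 1
      ext a
      simp only [touchedSet, Finset.mem_filter, G.untouched_succ]
      tauto
    · have hset : G.touchedSet i (k + 1) =
          insert (G.fst k) (insert (G.snd k) (G.touchedSet i k)) := by
        ext a
        simp only [touchedSet, Finset.mem_filter, Finset.mem_insert, G.untouched_succ]
        have hu := G.fst_mem hkm
        have hv := G.snd_mem hkm
        constructor
        · tauto
        · rintro (rfl | rfl | h') <;> tauto
      rw [G.firstTouchSet_succ _ hi h, G.firstTouchSet_succ _ hi h, hset]
      have hu : G.fst k ∈ G.touchedSet i k ↔ ¬G.Untouched i k (G.fst k) := by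
        simp only [touchedSet, Finset.mem_filter, G.fst_mem hkm, true_and]
      have hv : G.snd k ∈ G.touchedSet i k ↔ ¬G.Untouched i k (G.snd k) := by
        simp only [touchedSet, Finset.mem_filter, G.snd_mem hkm, true_and]
      rw [Finset.card_insert_eq_ite, Finset.card_insert_eq_ite]
      simp only [Finset.mem_insert, hu, hv, h, false_or]
      split_ifs <;> omega

theorem exists_adj_iff {i k : ℕ} (a : Fin n) (hk : k ≤ m) :
    (∃ b, (G.window i k).Adj a b) ↔ ¬G.Untouched i k (a + 1) := by
  constructor
  · rintro ⟨b, hb⟩ h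
    obtain ⟨hne, l, h₁, h₂, h₃⟩ := (G.window_adj_iff a b).1 hb
    have hne' : (a : ℕ) ≠ b := fun h => hne (Fin.ext h)
    have := h l h₁ h₂ (by omega)
    omega
  · intro h
    unfold Untouched at h
    push Not at h
    obtain ⟨l, h₁, h₂, h₃, h₄⟩ := h
    have hu := Finset.mem_Icc.1 (G.fst_mem (by omega : l < m))
    have hv := Finset.mem_Icc.1 (G.snd_mem (by omega : l < m))
    by_cases ha : (a : ℕ) + 1 = G.fst l
    · refine ⟨⟨G.snd l - 1, by omega⟩, (G.window_adj_iff _ _).2 ⟨?_, l, h₁, h₂, .inl ⟨ha, ?_⟩⟩⟩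
      · intro h
        have := congrArg Fin.val h
        simp only at this
        omega
      · simp only
        omega
    · refine ⟨⟨G.fst l - 1, by omega⟩, (G.window_adj_iff _ _).2 ⟨?_, l, h₁, h₂, .inr ⟨?_, h₄ ha⟩⟩⟩
      · have := h₄ ha
        intro h
        have := congrArg Fin.val h
        simp only at this
        omega
      · simp only
        omega

theorem card_exists_adj {i k : ℕ} (hk : k ≤ m) :
    Nat.card {a // ∃ b, (G.window i k).Adj a b} = (G.touchedSet i k).card := by
  classical
  rw [Nat.card_eq_fintype_card, Fintype.card_subtype]
  refine Finset.card_bij (fun a _ => (a : ℕ) + 1) ?_ (fun a _ b _ h => Fin.ext (by omega)) ?_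
  · intro a ha
    simp only [Finset.mem_filter, Finset.mem_univ, true_and, G.exists_adj_iff _ hk] at ha
    simp only [touchedSet, Finset.mem_filter, Finset.mem_Icc]
    exact ⟨by omega, ha⟩
  · intro a ha
    simp only [touchedSet, Finset.mem_filter, Finset.mem_Icc] at ha
    refine ⟨⟨a - 1, by omega⟩, ?_, by simp only; omega⟩
    simp only [Finset.mem_filter, Finset.mem_univ, true_and, G.exists_adj_iff _ hk]
    have : a - 1 + 1 = a := by omega
    rw [this]
    exact ha.2

/-- The trivial components are the untouched vertices, that is, `n` minus the touched ones. -/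
theorem numNontrivial_eq {i j : ℕ} (hj : j < m) :
    (G.numNontrivial i j : ℤ) = G.numComponents i j + (G.touchedSet i (j + 1)).card - n := by
  classical
  have h1 := SimpleGraph.card_nontrivial_add (H := G.slice i j)
  have h2 := G.card_exists_adj (i := i) (k := j + 1) hj
  have h3 : Nat.card {a // ∃ b, (G.window i (j + 1)).Adj a b} +
      Nat.card {a // ¬∃ b, (G.window i (j + 1)).Adj a b} = n := by
    rw [← Nat.card_sum, Nat.card_congr (Equiv.sumCompl _), Nat.card_fin]
  unfold numNontrivial numComponents
  unfold slice at *
  omega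

theorem avgComponentSize_eq (i j : ℕ) : G.avgComponentSize i j = n / G.numComponents i j := by
  have h := SimpleGraph.finsum_ncard_supp (H := G.slice i j) fun _ => True
  unfold avgComponentSize
  congr 1
  rw [Nat.card_congr (Equiv.subtypeUnivEquiv fun _ => trivial), Nat.card_fin] at h
  rw [← h]
  exact (finsum_comp_equiv (Equiv.subtypeUnivEquiv fun _ => trivial)
    (f := fun c : (G.slice i j).ConnectedComponent => (c.supp.ncard : ℚ))).symm

theorem avgNontrivialSize_eq {i j : ℕ} (hj : j < m) :
    G.avgNontrivialSize i j = (G.touchedSet i (j + 1)).card / G.numNontrivial i j := by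
  unfold avgNontrivialSize
  rw [SimpleGraph.finsum_ncard_supp, ← G.card_exists_adj hj]
  simp only [SimpleGraph.one_lt_ncard_supp_iff]
  rfl

end RelationalEventGraph

/-! ## The point sets and the queries -/

namespace Dominance

variable {P : List (ℕ × ℕ)} {N : ℕ} {g : ℕ → ℕ}

open Classical in
theorem count_eq (hP : P = (List.range N).map fun t => (t + 1, g t)) (Q : Quadrant) (q : ℤ × ℤ) :
    count P Q q = ((Finset.range N).filter fun t : ℕ =>
      Q.Contains q (((t + 1 : ℕ) : ℤ), (g t : ℤ))).card := by
  rw [count, hP, List.countP_map, List.countP_eq_length_filter]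
  simp only [Finset.card, Finset.filter, Finset.range, Multiset.range, Multiset.filter_coe,
    Multiset.coe_card]
  congr

theorem isInstance_of_eq (hP : P = (List.range N).map fun t => (t + 1, g t))
    (hg : ∀ t < N, 1 ≤ g t ∧ g t ≤ t + 1) : IsInstance P := by
  subst hP
  refine ⟨List.Nodup.map (fun a b h => by simpa using (Prod.ext_iff.1 h).1) List.nodup_range, ?_⟩
  intro p hp
  obtain ⟨t, ht, rfl⟩ := List.mem_map.1 hp
  have ht := List.mem_range.1 ht
  have := hg t ht
  simp only [List.length_map, List.length_range]
  omega

open Classical in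
/-- Counting the points with abscissa at most `j + 2` and ordinate at least `i + 2`. -/
theorem count_lege {m i j : ℕ} (hP : P = (List.range (m + 1)).map fun t => (t + 1, g t))
    (h0 : g 0 = 1) (hg : ∀ l < m, g (l + 1) ≤ l + 2) (hj : j < m) :
    count P .lege ((j : ℤ) + 2, (i : ℤ) + 2) =
      ((Finset.Ico i (j + 1)).filter fun l => i + 2 ≤ g (l + 1)).card := by
  rw [count_eq hP]
  symm
  refine Finset.card_bij (fun l _ => l + 1) ?_ (fun a _ b _ h => by omega) ?_
  · intro l hl
    simp only [Finset.mem_filter, Finset.mem_Ico] at hl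
    rw [Finset.mem_filter, Finset.mem_range]
    simp only [Quadrant.Contains]
    push_cast
    omega
  · intro t ht
    rw [Finset.mem_filter, Finset.mem_range] at ht
    simp only [Quadrant.Contains] at ht
    push_cast at ht
    cases t with
    -- The extra point has ordinate `1 < i + 2` and is not counted.
    | zero => omega
    | succ l =>
      -- From `i + 2 ≤ g (l + 1) ≤ l + 2` follows `i ≤ l`, so a single quadrant suffices.
      have := hg l (by omega)
      refine ⟨l, ?_, rfl⟩
      simp only [Finset.mem_filter, Finset.mem_Ico]
      push_cast at ht
      omega

open Classical in
/-- Counting the points with abscissa between `i + 2` and `j + 2` and ordinate at most `i + 1`. -/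
theorem count_gele {m i j : ℕ} (hP : P = (List.range (m + 1)).map fun t => (t + 1, g t))
    (hi : i ≤ j) (hj : j < m) :
    (count P .gele ((i : ℤ) + 2, (i : ℤ) + 1) : ℤ) - count P .gele ((j : ℤ) + 3, (i : ℤ) + 1) =
      ((Finset.Ico i (j + 1)).filter fun l => g (l + 1) ≤ i + 1).card := by
  rw [count_eq hP, count_eq hP]
  have hcard : ((Finset.Ico i (j + 1)).filter fun l => g (l + 1) ≤ i + 1).card =
      ((Finset.Ico (i + 1) (j + 2)).filter fun t => g t ≤ i + 1).card := by
    refine Finset.card_bij (fun l _ => l + 1) ?_ (fun a _ b _ h => by omega) ?_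
    · intro l hl
      simp only [Finset.mem_filter, Finset.mem_Ico] at hl ⊢
      omega
    · intro t ht
      simp only [Finset.mem_filter, Finset.mem_Ico] at ht
      have h1 : t - 1 + 1 = t := by omega
      refine ⟨t - 1, ?_, h1⟩
      simp only [Finset.mem_filter, Finset.mem_Ico, h1]
      omega
  -- Here the ordinate does not bound the abscissa below; the quadrant from `i + 2` on is the
  -- disjoint union of the slice and the quadrant from `j + 3` on.
  rw [hcard, sub_eq_iff_eq_add, ← Nat.cast_add, Nat.cast_inj, ← Finset.card_union_of_disjoint]
  · congr 1
    ext t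
    rw [Finset.mem_union, Finset.mem_filter, Finset.mem_filter, Finset.mem_filter]
    simp only [Finset.mem_range, Finset.mem_Ico, Quadrant.Contains]
    push_cast
    omega
  · rw [Finset.disjoint_left]
    intro t ht ht'
    rw [Finset.mem_filter] at ht ht'
    simp only [Finset.mem_range, Finset.mem_Ico, Quadrant.Contains] at ht ht'
    push_cast at ht'
    omega

/-- The number of loopy edges. -/
def loopyQuery : Query 3 :=
  .dominance 0 .lege (.add .last (.const 2)) (.add .first (.const 2))

/-- The number of components. -/
def componentsQuery : Query 3 :=
  .sub (.add (.add .numVertices loopyQuery) .first) (.add .last (.const 1))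

/-- The number of edges of the slice that are the first to touch one of their endpoints. -/
def firstTouchQuery (s : Fin 3) : Query 3 :=
  .sub (.dominance s .gele (.add .first (.const 2)) (.add .first (.const 1)))
    (.dominance s .gele (.add .last (.const 3)) (.add .first (.const 1)))

/-- The number of vertices of nontrivial components. -/
def touchedQuery : Query 3 := .add (firstTouchQuery 1) (firstTouchQuery 2)

/-- The number of nontrivial components. -/
def nontrivialQuery : Query 3 := .sub (.add componentsQuery touchedQuery) .numVertices

/-- The point sets represent the graph. -/
structure Represents {n m : ℕ} (G : RelationalEventGraph n m) (P : Fin 3 → List (ℕ × ℕ))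
    (g : Fin 3 → ℕ → ℕ) : Prop where
  eq : ∀ s, P s = (List.range (m + 1)).map fun t => (t + 1, g s t)
  zero : ∀ s, g s 0 = 1
  loops : ∀ l < m, G.LoopBound l (g 0 (l + 1))
  touch₁ : ∀ l < m, G.TouchBound l (G.fst l) (g 1 (l + 1))
  touch₂ : ∀ l < m, G.TouchBound l (G.snd l) (g 2 (l + 1))

variable {n m : ℕ} {G : RelationalEventGraph n m} {P : Fin 3 → List (ℕ × ℕ)} {g : Fin 3 → ℕ → ℕ}

theorem Represents.isInstance (h : Represents G P g) (s : Fin 3) : IsInstance (P s) := by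
  refine isInstance_of_eq (h.eq s) fun t ht => ?_
  cases t with
  | zero => rw [h.zero]; omega
  | succ l =>
    have hl : l < m := by omega
    fin_cases s
    · exact ⟨(h.loops l hl).pos, (h.loops l hl).le⟩
    · exact ⟨(h.touch₁ l hl).pos, (h.touch₁ l hl).le⟩
    · exact ⟨(h.touch₂ l hl).pos, (h.touch₂ l hl).le⟩

theorem Represents.eval_loopy (h : Represents G P g) {i j : ℕ} (hj : j < m) :
    loopyQuery.eval P n m i j = (G.loopySet i (j + 1)).card := by
  simp only [loopyQuery, Query.eval]
  rw [count_lege (h.eq 0) (h.zero 0) (fun l hl => (h.loops l hl).le) hj]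
  congr 2
  ext l
  simp only [RelationalEventGraph.loopySet, Finset.mem_filter, Finset.mem_Ico]
  refine and_congr_right fun hl => ?_
  exact (h.loops l (by omega)).iff i hl.1

theorem Represents.eval_components (h : Represents G P g) {i j : ℕ} (hi : i ≤ j) (hj : j < m) :
    componentsQuery.eval P n m i j = G.numComponents i j := by
  rw [G.numComponents_eq hi hj, ← h.eval_loopy hj]
  simp only [componentsQuery, Query.eval]

theorem Represents.eval_touched (h : Represents G P g) {i j : ℕ} (hi : i ≤ j) (hj : j < m) :
    touchedQuery.eval P n m i j = (G.touchedSet i (j + 1)).card := by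
  rw [G.card_touchedSet (by omega) hj]
  simp only [touchedQuery, firstTouchQuery, Query.eval]
  rw [count_gele (h.eq 1) hi hj, count_gele (h.eq 2) hi hj]
  push_cast
  congr 3
  · ext l
    simp only [RelationalEventGraph.firstTouchSet, Finset.mem_filter, Finset.mem_Ico]
    exact and_congr_right fun hl => (h.touch₁ l (by omega)).iff i hl.1
  · ext l
    simp only [RelationalEventGraph.firstTouchSet, Finset.mem_filter, Finset.mem_Ico]
    exact and_congr_right fun hl => (h.touch₂ l (by omega)).iff i hl.1

theorem Represents.eval_nontrivial (h : Represents G P g) {i j : ℕ} (hi : i ≤ j) (hj : j < m) :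
    nontrivialQuery.eval P n m i j = G.numNontrivial i j := by
  rw [G.numNontrivial_eq hj, ← h.eval_components hi hj, ← h.eval_touched hi hj]
  simp only [nontrivialQuery, Query.eval]

end Dominance

/-! ### The final memory as point sets, and the resource limits -/

namespace RAM

theorem represents {n m : ℕ} {G : RelationalEventGraph n m} {σ τ : State} (hI : MainInv G m τ)
    (hmem : σ.mem = τ.mem) (h0 : σ.reg 0 = 2 * m) (h1 : σ.reg 1 = m + 1)
    (h2 : σ.reg 2 = 4 * m + 2) (h3 : σ.reg 3 = m + 1) (h4 : σ.reg 4 = 6 * m + 4)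
    (h5 : σ.reg 5 = m + 1) :
    Dominance.Represents G (outputs 3 σ) fun s t => σ.mem (σ.reg (2 * s) + 2 * t + 1) := by
  have r0 : σ.reg (2 * ((0 : Fin 3) : ℕ)) = 2 * m := h0
  have r2 : σ.reg (2 * ((1 : Fin 3) : ℕ)) = 4 * m + 2 := h2
  have r4 : σ.reg (2 * ((2 : Fin 3) : ℕ)) = 6 * m + 4 := h4
  have r1 : σ.reg (2 * ((0 : Fin 3) : ℕ) + 1) = m + 1 := h1
  have r3 : σ.reg (2 * ((1 : Fin 3) : ℕ) + 1) = m + 1 := h3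
  have r5 : σ.reg (2 * ((2 : Fin 3) : ℕ) + 1) = m + 1 := h5
  have fin3 : ∀ p : Fin 3 → Prop, p 0 → p 1 → p 2 → ∀ s, p s := by
    intro p h0 h1 h2 s
    fin_cases s <;> assumption
  have hlen : ∀ s : Fin 3, σ.reg (2 * (s : ℕ) + 1) = m + 1 := fin3 _ r1 r3 r5
  refine ⟨fun s => ?_, ?_, fun l hl => ?_, fun l hl => ?_, fun l hl => ?_⟩
  · simp only [outputs, output, hlen]
    refine List.map_congr_left fun t ht => ?_
    have ht := List.mem_range.1 ht
    refine Prod.ext ?_ rfl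
    simp only [hmem]
    revert s
    refine fin3 _ ?_ ?_ ?_
    · rw [r0]
      cases t with
      | zero => exact hI.base₀.1
      | succ l => exact (hI.point₀ l (by omega)).1
    · rw [r2]
      cases t with
      | zero => exact hI.base₁.1
      | succ l =>
        rw [show 4 * m + 2 + 2 * (l + 1) = 4 * m + 2 * l + 4 by omega]
        exact (hI.point₁ l (by omega)).1
    · rw [r4]
      cases t with
      | zero => exact hI.base₂.1
      | succ l =>
        rw [show 6 * m + 4 + 2 * (l + 1) = 6 * m + 2 * l + 6 by omega]
        exact (hI.point₂ l (by omega)).1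
  · simp only [hmem]
    refine fin3 _ ?_ ?_ ?_
    · rw [r0]; exact hI.base₀.2
    · rw [r2]; exact hI.base₁.2
    · rw [r4]; exact hI.base₂.2
  · rw [r0, hmem, show 2 * m + 2 * (l + 1) + 1 = 2 * m + 2 * l + 3 by omega]
    exact (hI.point₀ l hl).2
  · rw [r2, hmem, show 4 * m + 2 + 2 * (l + 1) + 1 = 4 * m + 2 * l + 5 by omega]
    exact (hI.point₁ l hl).2
  · rw [r4, hmem, show 6 * m + 4 + 2 * (l + 1) + 1 = 6 * m + 2 * l + 7 by omega]
    exact (hI.point₂ l hl).2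

theorem limits (n m : ℕ) {C : ℕ} (hC : 10 ≤ C) :
    Limits n m (C * (n + m + 1)) ((n + m + 2) ^ C) := by
  refine ⟨le_trans (by omega) (Nat.mul_le_mul_right (n + m + 1) hC), ?_⟩
  -- The base is at least `2`, and `100 ≤ 2 ^ 7`.
  have h1 : 128 * (n + m + 2) ≤ (n + m + 2) ^ 8 := by
    rw [pow_succ]
    exact Nat.mul_le_mul_right _ ((by norm_num : 128 = 2 ^ 7).le.trans
      (Nat.pow_le_pow_left (by omega) 7))
  have h2 : (n + m + 2) ^ 8 ≤ (n + m + 2) ^ C := Nat.pow_le_pow_right (by omega) (by omega)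
  exact le_trans (by omega) (h1.trans h2)

end RAM

/-! ### The reduction -/

theorem mainTheorem2 :
    ∃ (K C : ℕ) (p : RAM.Prog)
      (components nontrivial avgNum avgDen avgNontrivialNum avgNontrivialDen loopy :
        Dominance.Query K),
      ∀ (n m : ℕ) (G : RelationalEventGraph n m),
        ∃ (t : ℕ) (σ : RAM.State),
          -- preprocessing in time `O(m log n)` and linear space, with words of `O(log (n + m))` bits
          RAM.Exec (C * (n + m + 1)) ((n + m + 2) ^ C) p (RAM.input G) t σ ∧
          t ≤ C * (m * (Nat.log 2 n + 1) + 1) ∧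
          -- the output consists of `K` dominance counting data sets, with `O(1)` points per edge
          (∀ s : Fin K, RAM.OutputFits (C * (n + m + 1)) σ s ∧
            (RAM.outputs K σ s).length ≤ C * m ∧ Dominance.IsInstance (RAM.outputs K σ s)) ∧
          -- every slice query is answered by dominance counting in these sets
          ∀ i j : ℕ, i ≤ j → j < m →
            components.eval (RAM.outputs K σ) n m i j = G.numComponents i j ∧
            nontrivial.eval (RAM.outputs K σ) n m i j = G.numNontrivial i j ∧
            (avgDen.eval (RAM.outputs K σ) n m i j ≠ 0 ∧
              (avgNum.eval (RAM.outputs K σ) n m i j : ℚ) /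
                  (avgDen.eval (RAM.outputs K σ) n m i j : ℚ) =
                G.avgComponentSize i j) ∧
            (G.numNontrivial i j ≠ 0 →
              avgNontrivialDen.eval (RAM.outputs K σ) n m i j ≠ 0 ∧
              (avgNontrivialNum.eval (RAM.outputs K σ) n m i j : ℚ) /
                  (avgNontrivialDen.eval (RAM.outputs K σ) n m i j : ℚ) =
                G.avgNontrivialSize i j) ∧
            loopy.eval (RAM.outputs K σ) n m i j = G.numLoopyEdges i j := by
  refine ⟨3, 6000, RAM.mainProg, Dominance.componentsQuery, Dominance.nontrivialQuery,
    .numVertices, Dominance.componentsQuery, Dominance.touchedQuery, Dominance.nontrivialQuery,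
    Dominance.loopyQuery, fun n m G => ?_⟩
  have hL := RAM.limits n m (C := 6000) (by norm_num)
  -- In general each set has `m + 1` points, which is `O(m)` only for `m ≠ 0`.
  by_cases hm : m = 0
  · subst hm
    have hreg : ∀ s, (RAM.input G).reg (2 * s + 1) = 0 := by
      intro s
      change (if 2 * s + 1 = 0 then n else if 2 * s + 1 = 1 then 0 else 0) = 0
      rw [if_neg (by omega), ite_self]
    have hout : ∀ s : Fin 3, RAM.outputs 3 (RAM.input G) s = [] := by
      intro s
      simp [RAM.outputs, RAM.output, hreg]
    refine ⟨_, _, .ite_false _ _ _ _ _ _ (RAM.eval_reg rfl (by have := hL.word; omega))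
      (.skip _), ?_, fun s => ⟨?_, ?_, ?_⟩, fun i j _ hj => absurd hj (Nat.not_lt_zero j)⟩
    · have : (RAM.Expr.reg 1).cost = 1 := rfl
      omega
    · rw [RAM.OutputFits, hreg]
      simp only [RAM.input]
      split_ifs <;> omega
    · simp [hout]
    · simp [hout, Dominance.IsInstance]
  · obtain ⟨t, σ, τ, he, ht, hI, hmem, h0, h1, h2, h3, h4, h5⟩ := RAM.exec_main hL G hm
    have hR := RAM.represents hI hmem h0 h1 h2 h3 h4 h5
    refine ⟨t, σ, he, ht, fun s => ⟨?_, ?_, hR.isInstance s⟩, fun i j hi hj => ?_⟩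
    · fin_cases s
      · change σ.reg 0 + 2 * σ.reg 1 ≤ _
        omega
      · change σ.reg 2 + 2 * σ.reg 3 ≤ _
        omega
      · change σ.reg 4 + 2 * σ.reg 5 ≤ _
        omega
    · rw [hR.eq s, List.length_map, List.length_range]
      omega
    -- An edge exists, so there is a vertex; thus the denominator of (c) is never zero.
    · have hn : (0 : ℤ) < G.numComponents i j := by
        have hpos : 0 < n := (Nat.zero_le _).trans_lt (G.edge ⟨j, hj⟩).1.isLt
        have : Nonempty (G.slice i j).ConnectedComponent :=
          ⟨(G.slice i j).connectedComponentMk ⟨0, hpos⟩⟩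
        exact_mod_cast Nat.card_pos (α := (G.slice i j).ConnectedComponent)
      rw [hR.eval_components hi hj, hR.eval_nontrivial hi hj, hR.eval_touched hi hj,
        hR.eval_loopy hj, G.numLoopyEdges_eq hj, G.avgComponentSize_eq,
        G.avgNontrivialSize_eq hj]
      refine ⟨rfl, rfl, ⟨hn.ne', ?_⟩, fun h => ⟨by exact_mod_cast h, ?_⟩, rfl⟩
      · simp only [Dominance.Query.eval, Int.cast_natCast]
      · simp only [Int.cast_natCast]
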